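/- Let $g\ge 1$ and let $\mathbb R\langle x\rangle$ be the algebra of real polynomials in noncommuting variables $x_1,\dots,x_g$, with the involution ${}^T$ that fixes each $x_j$ and reverses words; $p$ is symmetric if $p=p^T$. The Hessian $p''(x)[h]=\frac{d^2}{dt^2}p(x+th)|_{t=0}$ is a polynomial in the $2g$ symmetric noncommuting variables $x_1,\dots,x_g,h_1,\dots,h_g$, and $\sigma_-^{\min}(p'')$ denotes the least number $\sigma_-$ of negative squares in a representation $$p''(x)[h]=\sum_{j=1}^{\sigma_+} f_j^+(x)[h]^T f_j^+(x)[h]-\sum_{\ell=1}^{\sigma_-} f_\ell^-(x)[h]^T f_\ell^-(x)[h]$$ by noncommutative polynomials $f_j^{+},f_\ell^-$ in $x$ and $h$ that are $0$ or homogeneous of degree one in $h$. For a noncommutative quadratic form $q=\sum_{i,j}q_{ij}x_ix_j$ write $Q(q)=[q_{ij}]\in\mathbb R^{g\times g}$. **Theorem.** Let $p$ be a symmetric noncommutative polynomial of degree $d$ in $x_1,\dots,x_g$. 1. $\sigma_-^{\min}(p'')\le 1$ if and only if $$p=p_0+p_1+p_2+\varphi q+q^T\varphi+\varphi f_0\varphi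 \qquad (*)$$ for some symmetric polynomials $p_0,p_1,p_2$, where each $p_j$ is $0$ or homogeneous of degree $j$; some $\varphi=\sum_j u_jx_j$ with $u\in\mathbb R^g$ a unit vector; and some polynomials $q,f_0$, each $0$ or homogeneous of degree two; such that, with $P=I-uu^T$, the matrix $$E_2=\begin{bmatrix}PQ(p_2)P & PQ(q)^T\\ Q(q)P & Q(f_0)\end{bmatrix}$$ is symmetric and positive semidefinite. 2. If in addition $d=3$, then in every representation $(*)$ as in part 1 one has $f_0=0$ and $q=f_1\varphi$ for some polynomial $f_1$ that is $0$ or homogeneous of degree one. 3. $\sigma_-^{\min}(p'')=0$ if and only if $d\le 2$ and the homogeneous part $p_2$ of degree two of $p$ satisfies $p_2(X)\succeq 0$ for every $n$ and every $g$-tuple $X$ of real symmetric $n\times n$ matrices. -/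

import Mathlib

open scoped Matrix

noncomputable section

/-- Polynomials with real coefficients in the noncommuting symmetric variables `x₁, …, x_g`.
The involution `star` of Mathlib fixes every variable and reverses every word, so a polynomial
is symmetric exactly if `IsSelfAdjoint p`. -/
abbrev NCPoly (g : ℕ) : Type := FreeAlgebra ℝ (Fin g)

/-- Polynomials in the `2g` noncommuting symmetric variables
`x₁, …, x_g` (indexed by `Sum.inl`) and `h₁, …, h_g` (indexed by `Sum.inr`). -/
abbrev NCPolyXH (g : ℕ) : Type := FreeAlgebra ℝ (Fin g ⊕ Fin g)

namespace NCPoly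

/-- The coefficients of a noncommutative polynomial, as a finitely supported function of the
word (a list of letters). -/
def coeffs {α : Type} (p : FreeAlgebra ℝ α) : FreeMonoid α →₀ ℝ :=
  (FreeAlgebra.equivMonoidAlgebraFreeMonoid p).coeff

/-- The coefficient of the word `w` in `p`. -/
def coeff {α : Type} (p : FreeAlgebra ℝ α) (w : List α) : ℝ :=
  coeffs p (FreeMonoid.ofList w)

/-- The monomial given by a word. -/
def word {α : Type} (w : List α) : FreeAlgebra ℝ α :=
  (w.map (FreeAlgebra.ι ℝ)).prod

/-- The degree: the maximal length of a word that occurs in `p` (and `0` for `p = 0`). -/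
def degree {α : Type} (p : FreeAlgebra ℝ α) : ℕ :=
  (coeffs p).support.sup FreeMonoid.length

/-- `p` is `0` or homogeneous of degree `k`. -/
def IsHomogeneous {α : Type} (p : FreeAlgebra ℝ α) (k : ℕ) : Prop :=
  ∀ w : List α, coeff p w ≠ 0 → w.length = k

/-- The homogeneous part of degree `k` of `p`. -/
def homogeneousPart {α : Type} (p : FreeAlgebra ℝ α) (k : ℕ) : FreeAlgebra ℝ α :=
  ∑ w ∈ (coeffs p).support.filter (fun w => w.length = k), coeffs p w • word w.toList

/-- `f(x)[h]` is `0` or homogeneous of degree one in `h`: exactly one letter of every word that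
occurs in `f` is one of the `h_j`. -/
def IsLinearInH {g : ℕ} (f : NCPolyXH g) : Prop :=
  ∀ w : List (Fin g ⊕ Fin g), coeff f w ≠ 0 → w.countP Sum.isRight = 1

/-- `p(x + t h)`, as a polynomial in a central variable `t` with coefficients in the
noncommutative polynomials in `x` and `h`. -/
def shift {g : ℕ} : NCPoly g →ₐ[ℝ] Polynomial (NCPolyXH g) :=
  FreeAlgebra.lift ℝ fun j =>
    Polynomial.C (FreeAlgebra.ι ℝ (Sum.inl j)) +
      Polynomial.X * Polynomial.C (FreeAlgebra.ι ℝ (Sum.inr j))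

/-- The Hessian `p''(x)[h]`: the second derivative of `p(x + t h)` with respect to `t`
at `t = 0`. -/
def hessian {g : ℕ} (p : NCPoly g) : NCPolyXH g :=
  (Polynomial.derivative (Polynomial.derivative (shift p))).eval 0

/-- `F` is a sum of squares minus a sum of `n` squares of polynomials in `x` and `h` that are
homogeneous of degree one in `h`. -/
def HasSDS {g : ℕ} (F : NCPolyXH g) (n : ℕ) : Prop :=
  ∃ (m : ℕ) (a : Fin m → NCPolyXH g) (b : Fin n → NCPolyXH g),
    (∀ j, IsLinearInH (a j)) ∧ (∀ l, IsLinearInH (b l)) ∧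
      F = ∑ j, star (a j) * a j - ∑ l, star (b l) * b l

/-- The negative signature `σ₋^min(F)`: the least number of negative squares in a representation
of `F` as a sum and difference of squares (`⊤` if there is no such representation). -/
def negSignature {g : ℕ} (F : NCPolyXH g) : ℕ∞ :=
  ⨅ (n : ℕ) (_ : HasSDS F n), (n : ℕ∞)

/-- `p(X)` is positive semidefinite for every tuple `X` of real symmetric matrices of the same
size. -/
def MatrixPositive {g : ℕ} (p : NCPoly g) : Prop :=
  ∀ (n : ℕ) (X : Fin g → Matrix (Fin n) (Fin n) ℝ), (∀ j, (X j).IsSymm) →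
    (FreeAlgebra.lift ℝ X p).PosSemidef

/-- The linear form `φ = ∑ uⱼ xⱼ`. -/
def linForm {g : ℕ} (u : Fin g → ℝ) : NCPoly g :=
  ∑ j, u j • FreeAlgebra.ι ℝ j

/-- The matrix `Q(q) = [q_{ij}]` of a noncommutative quadratic form `q = ∑ q_{ij} xᵢ xⱼ`. -/
def quadMatrix {g : ℕ} (q : NCPoly g) : Matrix (Fin g) (Fin g) ℝ :=
  Matrix.of fun i j => coeff q [i, j]

/-- `P = I - u uᵀ`. -/
def projPerp {g : ℕ} (u : Fin g → ℝ) : Matrix (Fin g) (Fin g) ℝ :=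
  1 - Matrix.vecMulVec u u

/-- The block matrix `E₂ = [P Q(p₂) P, P Q(q)ᵀ; Q(q) P, Q(f₀)]`. -/
def blockE {g : ℕ} (p₂ : NCPoly g) (u : Fin g → ℝ) (q f₀ : NCPoly g) :
    Matrix (Fin g ⊕ Fin g) (Fin g ⊕ Fin g) ℝ :=
  Matrix.fromBlocks
    (projPerp u * quadMatrix p₂ * projPerp u) (projPerp u * (quadMatrix q)ᵀ)
    (quadMatrix q * projPerp u) (quadMatrix f₀)

/-- `p = p₀ + p₁ + p₂ + φ q + qᵀ φ + φ f₀ φ` with `φ = ∑ uⱼ xⱼ`, where `u` is a unit vector, each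
`pⱼ` is symmetric and `0` or homogeneous of degree `j`, `q` and `f₀` are `0` or homogeneous of
degree two, and `E₂` is positive semidefinite. -/
structure IsRepresentation {g : ℕ} (p p₀ p₁ p₂ : NCPoly g) (u : Fin g → ℝ)
    (q f₀ : NCPoly g) : Prop where
  symm₀ : IsSelfAdjoint p₀
  symm₁ : IsSelfAdjoint p₁
  symm₂ : IsSelfAdjoint p₂
  hom₀ : IsHomogeneous p₀ 0
  hom₁ : IsHomogeneous p₁ 1
  hom₂ : IsHomogeneous p₂ 2
  unit : u ⬝ᵥ u = 1
  hom_q : IsHomogeneous q 2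
  hom_f : IsHomogeneous f₀ 2
  eq : p = p₀ + p₁ + p₂ + linForm u * q + star q * linForm u + linForm u * f₀ * linForm u
  posSemidef : (blockE p₂ u q f₀).PosSemidef

end NCPoly

end

/-! The coefficient of a word `s.reverse h_k h_l t`, with `s` and `t` free of `h`, in the Hessian is
twice a coefficient of `p`. In a product of two polynomials linear in `h` such a word can be cut
only between `h_k` and `h_l`. Hence a representation of the Hessian by squares diagonalizes the
Hankel form `hankel p y z`, the functional of coefficients of `p` at `star y * z`, on polynomials
without constant term: its number of negative squares is at most that of the representation
(`two_mul_hankel_eq`).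

The degree of `p` is finite, so long words are isotropic for this form. A polynomial that is
isotropic and along which the form stays nonnegative is orthogonal to everything it can be added to
(`hankel_eq_zero_of_isotropic`). With no negative square this forces degree at most two. With one
negative square, the form is nonnegative on the `z` whose vector of letter coefficients is
orthogonal to a unit vector `u` (`exists_unit_hankel_nonneg`). Isotropic vectors in this space then
bound the degree by four, force quartic words to begin and end with `φ`, and force cubic words to
begin or end with `φ`. Positivity at `e + d φ`, with `e` and `d` linear and `e` orthogonal to `u`,
is exactly positivity of `E₂`.

Conversely, `(*)` splits half the Hessian into the form of `E₂` at the vector of the `h_i` and `h_i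
φ(x)`, a sum of squares, plus terms `φ(h) s + star s φ(h)`. By polarization, twice the latter is one
positive and one negative square. -/

namespace NCPoly

/-! ### Coefficients, words and linear functionals on the free algebra. -/

section Coefficients

variable {α : Type}

/-- The coefficients as a linear map. -/
noncomputable def coeffsLinear : FreeAlgebra ℝ α →ₗ[ℝ] (FreeMonoid α →₀ ℝ) :=
  (MonoidAlgebra.coeffLinearEquiv ℝ).toLinearMap ∘ₗ
    FreeAlgebra.equivMonoidAlgebraFreeMonoid.toLinearEquiv.toLinearMap

theorem coeffsLinear_apply (p : FreeAlgebra ℝ α) : coeffsLinear p = coeffs p := rfl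

@[simp]
theorem coeff_add (p q : FreeAlgebra ℝ α) (w : List α) :
    coeff (p + q) w = coeff p w + coeff q w := by
  simp [coeff, ← coeffsLinear_apply]

@[simp]
theorem coeff_sub (p q : FreeAlgebra ℝ α) (w : List α) :
    coeff (p - q) w = coeff p w - coeff q w := by
  simp [coeff, ← coeffsLinear_apply]

@[simp]
theorem coeff_zero (w : List α) : coeff (0 : FreeAlgebra ℝ α) w = 0 := by
  simp [coeff, ← coeffsLinear_apply]

@[simp]
theorem coeff_smul (c : ℝ) (p : FreeAlgebra ℝ α) (w : List α) :
    coeff (c • p) w = c * coeff p w := by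
  simp [coeff, ← coeffsLinear_apply]

@[simp]
theorem coeff_sum {ι : Type*} (s : Finset ι) (f : ι → FreeAlgebra ℝ α) (w : List α) :
    coeff (∑ i ∈ s, f i) w = ∑ i ∈ s, coeff (f i) w := by
  simp [coeff, ← coeffsLinear_apply, Finsupp.finsetSum_apply]

theorem ext_coeff {p q : FreeAlgebra ℝ α} (h : ∀ w, coeff p w = coeff q w) : p = q := by
  apply FreeAlgebra.equivMonoidAlgebraFreeMonoid.injective
  apply MonoidAlgebra.coeff_injective
  ext w
  exact h w.toList

@[simp]
theorem word_nil : word ([] : List α) = 1 := rfl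

@[simp]
theorem word_cons (a : α) (w : List α) : word (a :: w) = FreeAlgebra.ι ℝ a * word w := by
  simp [word]

theorem word_append (v w : List α) : word (v ++ w) = word v * word w := by
  simp [word]

theorem coeffs_word (w : List α) :
    coeffs (word w) = Finsupp.single (FreeMonoid.ofList w) 1 := by
  have : FreeAlgebra.equivMonoidAlgebraFreeMonoid (R := ℝ) (word w) =
      MonoidAlgebra.single (FreeMonoid.ofList w) 1 := by
    induction w with
    | nil => simp [MonoidAlgebra.one_def]
    | cons a w ih =>
      rw [word_cons, map_mul, ih]
      simp [FreeAlgebra.equivMonoidAlgebraFreeMonoid, MonoidAlgebra.single_mul_single,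
        FreeMonoid.ofList_cons]
  simp [coeffs, this]

theorem coeff_word [DecidableEq α] (v w : List α) :
    coeff (word v) w = if v = w then 1 else 0 := by
  classical
  rw [coeff, coeffs_word, Finsupp.single_apply]
  simp

theorem eq_sum_word (p : FreeAlgebra ℝ α) :
    p = ∑ w ∈ (coeffs p).support, coeffs p w • word w.toList := by
  classical
  apply ext_coeff
  intro w
  simp only [coeff_sum, coeff_smul, coeff_word]
  rw [Finset.sum_eq_single (FreeMonoid.ofList w)]
  · simp [coeff]
  · intro b _ hb
    rw [if_neg, mul_zero]
    rintro rfl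
    exact hb rfl
  · intro h
    simp [Finsupp.notMem_support_iff.mp h]

/-- Linear induction over the words that occur in a polynomial. -/
@[elab_as_elim]
theorem word_induction {P : FreeAlgebra ℝ α → Prop} (p : FreeAlgebra ℝ α)
    (zero : P 0) (add : ∀ a b, P a → P b → P (a + b)) (smul : ∀ (c : ℝ) a, P a → P (c • a))
    (word : ∀ w, coeff p w ≠ 0 → P (word w)) : P p := by
  rw [eq_sum_word p]
  refine Finset.sum_induction _ P add zero fun w hw => smul _ _ (word _ ?_)
  exact Finsupp.mem_support_iff.mp hw

@[simp]
theorem coeff_ι_mul_nil (a : α) (p : FreeAlgebra ℝ α) : coeff (FreeAlgebra.ι ℝ a * p) [] = 0 := by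
  classical
  refine word_induction p ?_ ?_ ?_ ?_
  · simp
  · intro p q hp hq
    simp [mul_add, hp, hq]
  · intro c p hp
    simp [hp]
  · intro w _
    rw [← word_cons, coeff_word]
    simp

theorem coeff_ι_mul_cons [DecidableEq α] (a b : α) (p : FreeAlgebra ℝ α) (w : List α) :
    coeff (FreeAlgebra.ι ℝ a * p) (b :: w) = if a = b then coeff p w else 0 := by
  refine word_induction p ?_ ?_ ?_ ?_
  · simp
  · intro p q hp hq
    rw [mul_add, coeff_add, hp, hq]
    split_ifs <;> simp
  · intro c p hp
    rw [mul_smul_comm, coeff_smul, hp]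
    split_ifs <;> simp
  · intro v _
    rw [← word_cons, coeff_word, coeff_word]
    by_cases h : a = b <;> simp [h]

theorem coeff_one_nil : coeff (1 : FreeAlgebra ℝ α) [] = 1 := by
  classical
  rw [← word_nil, coeff_word, if_pos rfl]

@[simp]
theorem star_smul_real (c : ℝ) (p : FreeAlgebra ℝ α) : star (c • p) = c • star p := by
  rw [Algebra.smul_def, star_mul, FreeAlgebra.star_algebraMap, Algebra.smul_def,
    Algebra.commutes]

theorem star_word (w : List α) : star (word w) = word w.reverse := by
  induction w with
  | nil => simp
  | cons a w ih => simp [ih, word_append]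

theorem coeff_star (p : FreeAlgebra ℝ α) (w : List α) : coeff (star p) w = coeff p w.reverse := by
  classical
  refine word_induction p ?_ ?_ ?_ ?_
  · simp
  · intro p q hp hq
    simp [hp, hq]
  · intro c p hp
    simp [hp]
  · intro v _
    rw [star_word, coeff_word, coeff_word]
    simp [List.reverse_eq_iff]

theorem coeff_mul (p q : FreeAlgebra ℝ α) (w : List α) :
    coeff (p * q) w =
      ∑ i ∈ Finset.range (w.length + 1), coeff p (w.take i) * coeff q (w.drop i) := by
  classical
  refine word_induction p ?_ ?_ ?_ ?_
  · simp
  · intro p p' hp hp'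
    simp [add_mul, hp, hp', Finset.sum_add_distrib]
  · intro c p hp
    simp [hp, Finset.mul_sum, mul_assoc]
  · intro v hv
    clear hv
    induction v generalizing w with
    | nil =>
      rw [word_nil, one_mul, Finset.sum_eq_single 0]
      · simp [coeff_one_nil]
      · intro i hi hi0
        rw [← word_nil, coeff_word, if_neg, zero_mul]
        intro h
        have := congrArg List.length h
        simp at this hi
        omega
      · simp
    | cons a v ih =>
      rw [word_cons, mul_assoc]
      cases w with
      | nil => simp
      | cons b w =>
        rw [coeff_ι_mul_cons, ih w, List.length_cons, Finset.sum_range_succ' _ (w.length + 1)]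
        by_cases h : a = b <;> simp [coeff_ι_mul_cons, h]

theorem exists_append_of_coeff_mul_ne_zero {p q : FreeAlgebra ℝ α} {w : List α}
    (h : coeff (p * q) w ≠ 0) : ∃ s t, w = s ++ t ∧ coeff p s ≠ 0 ∧ coeff q t ≠ 0 := by
  rw [coeff_mul] at h
  obtain ⟨i, _, hi⟩ := Finset.exists_ne_zero_of_sum_ne_zero h
  exact ⟨w.take i, w.drop i, by simp, left_ne_zero_of_mul hi, right_ne_zero_of_mul hi⟩

/-- The linear functional that takes the value `c w` at the word `w`. -/
noncomputable def pairing (c : List α → ℝ) : FreeAlgebra ℝ α →ₗ[ℝ] ℝ :=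
  Finsupp.linearCombination ℝ (fun w : FreeMonoid α => c w.toList) ∘ₗ coeffsLinear

@[simp]
theorem pairing_word (c : List α → ℝ) (w : List α) : pairing c (word w) = c w := by
  simp [pairing, coeffsLinear_apply, coeffs_word]

theorem pairing_word_mul (c : List α → ℝ) (v : List α) (p : FreeAlgebra ℝ α) :
    pairing c (word v * p) = pairing (fun w => c (v ++ w)) p := by
  refine word_induction p ?_ ?_ ?_ ?_
  · simp
  · intro p q hp hq
    simp [mul_add, hp, hq]
  · intro a p hp
    simp [hp]
  · intro w _
    rw [← word_append, pairing_word, pairing_word]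

theorem pairing_eq_zero {c : List α → ℝ} {p : FreeAlgebra ℝ α}
    (h : ∀ w, coeff p w ≠ 0 → c w = 0) : pairing c p = 0 := by
  refine word_induction p ?_ ?_ ?_ ?_
  · simp
  · intro p q hp hq
    simp [hp, hq]
  · intro a p hp
    simp [hp]
  · intro w hw
    simp [h w hw]

theorem pairing_star {c : List α → ℝ} (hc : ∀ w, c w.reverse = c w) (p : FreeAlgebra ℝ α) :
    pairing c (star p) = pairing c p := by
  refine word_induction p ?_ ?_ ?_ ?_
  · simp
  · intro p q hp hq
    simp [hp, hq]
  · intro a p hp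
    simp [hp]
  · intro w hw
    simp [star_word, hc]

theorem coeff_eq_zero_of_degree_lt {p : FreeAlgebra ℝ α} {w : List α}
    (h : degree p < w.length) : coeff p w = 0 := by
  by_contra hw
  have : FreeMonoid.length (FreeMonoid.ofList w) ≤ degree p :=
    Finset.le_sup (f := FreeMonoid.length) (Finsupp.mem_support_iff.mpr hw)
  exact absurd h (not_lt.mpr this)

/-- Positivity of the degree excludes the zero polynomial, to which `degree` assigns the default
value 0. -/
theorem exists_coeff_ne_zero_of_degree_pos {p : FreeAlgebra ℝ α} (h : 0 < degree p) :
    ∃ w : List α, w.length = degree p ∧ coeff p w ≠ 0 := by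
  have hne : (coeffs p).support.Nonempty := by
    by_contra hne
    rw [Finset.not_nonempty_iff_eq_empty] at hne
    simp [degree, hne] at h
  obtain ⟨w, hw, hw'⟩ := Finset.exists_mem_eq_sup _ hne FreeMonoid.length
  exact ⟨w.toList, hw'.symm, Finsupp.mem_support_iff.mp hw⟩

theorem coeff_homogeneousPart (p : FreeAlgebra ℝ α) (k : ℕ) (w : List α) :
    coeff (homogeneousPart p k) w = if w.length = k then coeff p w else 0 := by
  classical
  simp only [homogeneousPart, coeff_sum, coeff_smul, coeff_word]
  by_cases hw : coeff p w = 0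
  · rw [Finset.sum_eq_zero]
    · simp [hw]
    · intro v _
      split_ifs with h
      · subst h
        rw [mul_one]
        exact hw
      · simp
  · split_ifs with hk
    · rw [Finset.sum_eq_single (FreeMonoid.ofList w)]
      · simp [coeff]
      · intro b _ hb
        rw [if_neg, mul_zero]
        rintro rfl
        exact hb rfl
      · intro h
        exact absurd (Finset.mem_filter.mpr ⟨Finsupp.mem_support_iff.mpr hw, hk⟩) h
    · refine Finset.sum_eq_zero fun v hv => ?_
      rw [if_neg, mul_zero]
      rintro rfl
      exact hk (Finset.mem_filter.mp hv).2

theorem coeff_reverse {p : FreeAlgebra ℝ α} (hp : IsSelfAdjoint p) (w : List α) :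
    coeff p w.reverse = coeff p w := by
  rw [← coeff_star, hp.star_eq]

end Coefficients

/-! ### Taylor coefficients, the Hessian and its middle matrix at zero. -/

section Hessian

variable {g : ℕ}

/-- The Taylor coefficient of `tⁿ` in `p(x + t h)`, as a linear map. -/
noncomputable def taylor (n : ℕ) : NCPoly g →ₗ[ℝ] NCPolyXH g :=
  (Polynomial.lcoeff (NCPolyXH g) n).restrictScalars ℝ ∘ₗ shift.toLinearMap

theorem taylor_apply (n : ℕ) (p : NCPoly g) : taylor n p = (shift p).coeff n := rfl

theorem hessian_eq (p : NCPoly g) : hessian p = (2 : ℝ) • taylor 2 p := by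
  rw [hessian, ← Polynomial.coeff_zero_eq_eval_zero, Polynomial.coeff_derivative,
    Polynomial.coeff_derivative, taylor_apply]
  norm_num [two_smul, mul_two]

theorem taylor_mul_zero (p q : NCPoly g) : taylor 0 (p * q) = taylor 0 p * taylor 0 q := by
  simp [taylor_apply, Polynomial.mul_coeff_zero]

theorem taylor_mul_one (p q : NCPoly g) :
    taylor 1 (p * q) = taylor 0 p * taylor 1 q + taylor 1 p * taylor 0 q := by
  simp [taylor_apply, Polynomial.coeff_mul, Finset.Nat.sum_antidiagonal_eq_sum_range_succ_mk,
    Finset.sum_range_succ]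

theorem taylor_mul_two (p q : NCPoly g) :
    taylor 2 (p * q) =
      taylor 0 p * taylor 2 q + taylor 1 p * taylor 1 q + taylor 2 p * taylor 0 q := by
  simp [taylor_apply, Polynomial.coeff_mul, Finset.Nat.sum_antidiagonal_eq_sum_range_succ_mk,
    Finset.sum_range_succ]

theorem shift_ι (j : Fin g) :
    shift (FreeAlgebra.ι ℝ j) = Polynomial.C (FreeAlgebra.ι ℝ (Sum.inl j)) +
      Polynomial.X * Polynomial.C (FreeAlgebra.ι ℝ (Sum.inr j)) := by
  simp [shift]

theorem taylor_zero_ι (j : Fin g) : taylor 0 (FreeAlgebra.ι ℝ j) = FreeAlgebra.ι ℝ (Sum.inl j) := by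
  simp [taylor_apply, shift_ι]

theorem taylor_two_ι (j : Fin g) : taylor 2 (FreeAlgebra.ι ℝ j) = 0 := by
  simp [taylor_apply, shift_ι]

theorem taylor_zero_ι_mul (j : Fin g) (p : NCPoly g) :
    taylor 0 (FreeAlgebra.ι ℝ j * p) = FreeAlgebra.ι ℝ (Sum.inl j) * taylor 0 p := by
  rw [taylor_mul_zero, taylor_zero_ι]

theorem taylor_succ_ι_mul (n : ℕ) (j : Fin g) (p : NCPoly g) :
    taylor (n + 1) (FreeAlgebra.ι ℝ j * p) =
      FreeAlgebra.ι ℝ (Sum.inl j) * taylor (n + 1) p +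
        FreeAlgebra.ι ℝ (Sum.inr j) * taylor n p := by
  simp [taylor_apply, shift_ι, add_mul, mul_assoc, Polynomial.coeff_C_mul]

theorem taylor_zero_one : taylor 0 (1 : NCPoly g) = 1 := by
  simp [taylor_apply]

theorem taylor_succ_one (n : ℕ) : taylor (n + 1) (1 : NCPoly g) = 0 := by
  simp [taylor_apply, Polynomial.coeff_one]

/-- The word in `x` that is obtained from a word in `x` and `h` by replacing each `hⱼ` by `xⱼ`. -/
def forget (w : List (Fin g ⊕ Fin g)) : List (Fin g) := w.map (Sum.elim id id)

/-- Expanding the word at `x + t h` chooses which `n` letters become an `h`; each choice gives a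
different word, so every coefficient is 0 or 1. -/
theorem coeff_taylor_word (v : List (Fin g)) (n : ℕ) (w : List (Fin g ⊕ Fin g)) :
    coeff (taylor n (word v)) w =
      if v = forget w ∧ w.countP Sum.isRight = n then 1 else 0 := by
  induction v generalizing n w with
  | nil =>
    rw [word_nil]
    cases n with
    | zero =>
      rw [taylor_zero_one, ← word_nil, coeff_word]
      cases w <;> simp [forget]
    | succ n =>
      rw [taylor_succ_one]
      cases w <;> simp [forget]
  | cons a v ih =>
    rw [word_cons]
    cases n with
    | zero =>
      rw [taylor_zero_ι_mul]
      cases w with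
      | nil => simp [forget]
      | cons b w =>
        rw [coeff_ι_mul_cons, ih]
        cases b with
        | inl b =>
          by_cases h : a = b
          · simp [forget, h, -List.countP_eq_zero]
            congr
          · simp [forget, h]
        | inr b => simp [forget]
    | succ n =>
      rw [taylor_succ_ι_mul]
      cases w with
      | nil => simp [forget]
      | cons b w =>
        rw [coeff_add, coeff_ι_mul_cons, coeff_ι_mul_cons, ih, ih]
        cases b <;> by_cases h : v = List.map (Sum.elim id id) w <;>
          simp [forget, h, ← ite_and, List.countP_cons]

theorem coeff_taylor (p : NCPoly g) (n : ℕ) (w : List (Fin g ⊕ Fin g)) :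
    coeff (taylor n p) w = if w.countP Sum.isRight = n then coeff p (forget w) else 0 := by
  refine word_induction p ?_ ?_ ?_ ?_
  · simp
  · intro p q hp hq
    rw [map_add, coeff_add, hp, hq]
    split_ifs <;> simp
  · intro c p hp
    rw [map_smul, coeff_smul, hp]
    split_ifs <;> simp
  · intro v _
    rw [coeff_taylor_word, coeff_word]
    split_ifs <;> simp_all

/-- The coefficient of `h_k v` in a polynomial in `x` and `h`, as a function of the word `k v`. -/
noncomputable def borderCoeff (f : NCPolyXH g) : List (Fin g) → ℝ
  | [] => 0
  | k :: v => coeff f (Sum.inr k :: v.map Sum.inl)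

theorem countP_map_inl (v : List (Fin g)) :
    (v.map (Sum.inl : Fin g → Fin g ⊕ Fin g)).countP Sum.isRight = 0 := by
  rw [List.countP_eq_zero]
  simp

/-- Each factor must contain exactly one `h`, so of all cuts of the word only the one between the
two adjacent `h` letters contributes. -/
theorem coeff_star_mul_of_isLinearInH {a b : NCPolyXH g} (ha : IsLinearInH a) (hb : IsLinearInH b)
    {s t : List (Fin g ⊕ Fin g)} (k l : Fin g) (hs : s.countP Sum.isRight = 0)
    (ht : t.countP Sum.isRight = 0) :
    coeff (star a * b) (s.reverse ++ Sum.inr k :: Sum.inr l :: t) =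
      coeff a (Sum.inr k :: s) * coeff b (Sum.inr l :: t) := by
  rw [coeff_mul, Finset.sum_eq_single (s.length + 1)]
  · have h1 : (s.reverse ++ Sum.inr k :: Sum.inr l :: t).take (s.length + 1) =
        s.reverse ++ [Sum.inr k] := by
      rw [List.take_append, List.take_of_length_le (by simp)]
      simp
    have h2 : (s.reverse ++ Sum.inr k :: Sum.inr l :: t).drop (s.length + 1) =
        Sum.inr l :: t := by
      rw [List.drop_append, List.drop_of_length_le (by simp)]
      simp
    rw [h1, h2, coeff_star]
    simp
  · intro i _ hi
    by_contra hne
    have h1 := ha _ (by rw [← coeff_star]; exact left_ne_zero_of_mul hne)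
    have h2 := hb _ (right_ne_zero_of_mul hne)
    rw [List.countP_reverse] at h1
    rcases lt_or_gt_of_ne hi with h | h
    · rw [List.take_append_of_le_length (by simp; omega)] at h1
      have := (List.take_sublist i s.reverse).countP_le (p := Sum.isRight)
      rw [List.countP_reverse] at this
      omega
    · rw [List.drop_append, List.drop_of_length_le (by simp; omega), List.nil_append] at h2
      obtain ⟨m, hm⟩ : ∃ m, i - s.reverse.length = m + 2 :=
        ⟨i - s.length - 2, by simp; omega⟩
      rw [hm] at h2
      simp only [List.drop_succ_cons] at h2
      have := (List.drop_sublist m t).countP_le (p := Sum.isRight)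
      omega
  · simp

/-- Evaluation of the middle matrix of the Hessian at `x = 0`. -/
theorem two_mul_coeff_eq {p : NCPoly g} {m n : ℕ} {a : Fin m → NCPolyXH g}
    {b : Fin n → NCPolyXH g} (ha : ∀ j, IsLinearInH (a j)) (hb : ∀ l, IsLinearInH (b l))
    (h : hessian p = ∑ j, star (a j) * a j - ∑ l, star (b l) * b l)
    {v w : List (Fin g)} (hv : v ≠ []) (hw : w ≠ []) :
    2 * coeff p (v.reverse ++ w) =
      ∑ j, borderCoeff (a j) v * borderCoeff (a j) w -
        ∑ l, borderCoeff (b l) v * borderCoeff (b l) w := by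
  obtain ⟨k, v, rfl⟩ := List.exists_cons_of_ne_nil hv
  obtain ⟨l, w, rfl⟩ := List.exists_cons_of_ne_nil hw
  have key := congrArg (fun f => coeff f
    ((v.map Sum.inl).reverse ++ Sum.inr k :: Sum.inr l :: w.map Sum.inl)) h
  simp only [hessian_eq, coeff_smul, coeff_sub, coeff_sum, coeff_taylor] at key
  rw [if_pos (by simp only [List.countP_append, List.countP_reverse, List.countP_cons,
    countP_map_inl]; rfl)] at key
  have hf : forget ((v.map Sum.inl).reverse ++ Sum.inr k :: Sum.inr l :: w.map Sum.inl) =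
      (k :: v).reverse ++ l :: w := by
    simp [forget, Function.comp_def]
  rw [hf] at key
  rw [key]
  congr 1 <;> refine Finset.sum_congr rfl fun j _ => ?_
  · exact coeff_star_mul_of_isLinearInH (ha j) (ha j) k l (countP_map_inl v) (countP_map_inl w)
  · exact coeff_star_mul_of_isLinearInH (hb j) (hb j) k l (countP_map_inl v) (countP_map_inl w)

/-- The middle matrix of the Hessian at `x = 0`, as a bilinear form on noncommutative
polynomials. -/
noncomputable def hankel (p z z' : NCPoly g) : ℝ := pairing (coeff p) (star z * z')

/-- Both sides are bilinear, so words suffice. The empty word is excluded because a border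
coefficient needs a first letter to serve as the `h`. -/
theorem two_mul_hankel_eq {p : NCPoly g} {m n : ℕ} {a : Fin m → NCPolyXH g}
    {b : Fin n → NCPolyXH g} (ha : ∀ j, IsLinearInH (a j)) (hb : ∀ l, IsLinearInH (b l))
    (h : hessian p = ∑ j, star (a j) * a j - ∑ l, star (b l) * b l)
    {y z : NCPoly g} (hy : coeff y [] = 0) (hz : coeff z [] = 0) :
    2 * hankel p y z =
      ∑ j, pairing (borderCoeff (a j)) y * pairing (borderCoeff (a j)) z -
        ∑ l, pairing (borderCoeff (b l)) y * pairing (borderCoeff (b l)) z := by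
  unfold hankel
  refine word_induction y ?_ ?_ ?_ ?_
  · simp
  · intro y y' h1 h2
    simp only [star_add, add_mul, map_add, mul_add, h1, h2, Finset.sum_add_distrib]
    ring
  · intro c y h1
    simp only [star_smul_real, smul_mul_assoc, map_smul, smul_eq_mul, mul_assoc,
      ← Finset.mul_sum, ← mul_sub, ← h1]
    ring
  · intro v hv
    have hv0 : v ≠ [] := by rintro rfl; exact hv hy
    refine word_induction z ?_ ?_ ?_ ?_
    · simp
    · intro y y' h1 h2
      simp only [map_add, mul_add, h1, h2, Finset.sum_add_distrib]
      ring
    · intro c y h1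
      simp only [mul_smul_comm, map_smul, smul_eq_mul, mul_left_comm _ c,
        ← Finset.mul_sum, ← mul_sub, ← h1]
    · intro w hw
      have hw0 : w ≠ [] := by rintro rfl; exact hw hz
      rw [star_word, ← word_append]
      simp only [pairing_word]
      exact two_mul_coeff_eq ha hb h hv0 hw0

theorem hankel_nonneg_of_hasSDS_zero {p : NCPoly g} (h : HasSDS (hessian p) 0)
    {z : NCPoly g} (hz : coeff z [] = 0) : 0 ≤ hankel p z z := by
  obtain ⟨m, a, b, ha, hb, h⟩ := h
  have := two_mul_hankel_eq ha hb h hz hz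
  have h2 : 0 ≤ ∑ j, pairing (borderCoeff (a j)) z * pairing (borderCoeff (a j)) z :=
    Finset.sum_nonneg fun j _ => mul_self_nonneg _
  simp at this
  linarith

/-- `β` is the border functional of the only negative square; adding its square back leaves a sum of
squares. -/
theorem exists_hankel_bound_of_hasSDS_one {p : NCPoly g} (h : HasSDS (hessian p) 1) :
    ∃ β : NCPoly g →ₗ[ℝ] ℝ, ∀ z, coeff z [] = 0 → 0 ≤ 2 * hankel p z z + β z * β z := by
  obtain ⟨m, a, b, ha, hb, h⟩ := h
  refine ⟨pairing (borderCoeff (b 0)), fun z hz => ?_⟩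
  have := two_mul_hankel_eq ha hb h hz hz
  have h2 : 0 ≤ ∑ j, pairing (borderCoeff (a j)) z * pairing (borderCoeff (a j)) z :=
    Finset.sum_nonneg fun j _ => mul_self_nonneg _
  simp at this
  linarith

end Hessian

/-! ### Linear and quadratic forms in the free algebra. -/

section Forms

variable {g : ℕ}

theorem coeff_one (w : List (Fin g)) : coeff (1 : NCPoly g) w = if w = [] then 1 else 0 := by
  rw [← word_nil, coeff_word]
  simp only [eq_comm]

@[simp]
theorem coeff_linForm_mul_nil (u : Fin g → ℝ) (f : NCPoly g) : coeff (linForm u * f) [] = 0 := by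
  simp [linForm, Finset.sum_mul]

@[simp]
theorem coeff_linForm_mul_cons (u : Fin g → ℝ) (f : NCPoly g) (i : Fin g) (w : List (Fin g)) :
    coeff (linForm u * f) (i :: w) = u i * coeff f w := by
  simp [linForm, Finset.sum_mul, coeff_ι_mul_cons]

theorem star_linForm (u : Fin g → ℝ) : star (linForm u) = linForm u := by
  simp [linForm, star_sum]

@[simp]
theorem coeff_mul_linForm_append (u : Fin g → ℝ) (f : NCPoly g) (i : Fin g) (w : List (Fin g)) :
    coeff (f * linForm u) (w ++ [i]) = coeff f w * u i := by
  rw [← star_star (f * linForm u), coeff_star, star_mul, star_linForm]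
  simp [coeff_star, mul_comm]

theorem coeff_linForm (u : Fin g → ℝ) (i : Fin g) : coeff (linForm u) [i] = u i := by
  rw [← mul_one (linForm u), coeff_linForm_mul_cons, coeff_one, if_pos rfl, mul_one]

theorem isHomogeneous_linForm (u : Fin g → ℝ) : IsHomogeneous (linForm u) 1 := by
  intro w hw
  rw [← mul_one (linForm u)] at hw
  cases w with
  | nil => exact absurd (coeff_linForm_mul_nil u 1) hw
  | cons i w =>
    rw [coeff_linForm_mul_cons, coeff_one] at hw
    by_cases h : w = []
    · simp [h]
    · simp [h] at hw

/-- The noncommutative quadratic form `∑ Qᵢⱼ xᵢ xⱼ`. -/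
noncomputable def quadForm (Q : Matrix (Fin g) (Fin g) ℝ) : NCPoly g :=
  ∑ i, ∑ j, Q i j • word [i, j]

@[simp]
theorem coeff_quadForm (Q : Matrix (Fin g) (Fin g) ℝ) (i j : Fin g) :
    coeff (quadForm Q) [i, j] = Q i j := by
  simp only [quadForm, coeff_sum, coeff_smul, coeff_word, List.cons.injEq, and_true]
  rw [Finset.sum_eq_single i]
  · simp
  · intro b _ hb
    simp [hb]
  · simp

theorem isHomogeneous_quadForm (Q : Matrix (Fin g) (Fin g) ℝ) : IsHomogeneous (quadForm Q) 2 := by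
  intro w hw
  simp only [quadForm, coeff_sum, coeff_smul, coeff_word] at hw
  obtain ⟨i, _, hi⟩ := Finset.exists_ne_zero_of_sum_ne_zero hw
  obtain ⟨j, _, hj⟩ := Finset.exists_ne_zero_of_sum_ne_zero hi
  have h := right_ne_zero_of_mul hj
  by_cases h' : [i, j] = w
  · rw [← h']
    rfl
  · simp [h'] at h

@[simp]
theorem quadMatrix_quadForm (Q : Matrix (Fin g) (Fin g) ℝ) : quadMatrix (quadForm Q) = Q := by
  ext i j
  simp [quadMatrix]

theorem IsHomogeneous.coeff_eq_zero {p : NCPoly g} {n : ℕ} (hp : IsHomogeneous p n)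
    {w : List (Fin g)} (hw : w.length ≠ n) : coeff p w = 0 :=
  not_not.mp fun h => hw (hp w h)

theorem quadForm_quadMatrix {q : NCPoly g} (hq : IsHomogeneous q 2) :
    quadForm (quadMatrix q) = q := by
  apply ext_coeff
  intro w
  by_cases hw : w.length = 2
  · obtain ⟨i, j, rfl⟩ := List.length_eq_two.mp hw
    simp [quadMatrix]
  · rw [hq.coeff_eq_zero hw, (isHomogeneous_quadForm _).coeff_eq_zero hw]

theorem star_quadForm (Q : Matrix (Fin g) (Fin g) ℝ) : star (quadForm Q) = quadForm Qᵀ := by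
  simp only [quadForm, star_sum, star_smul_real, star_word]
  rw [Finset.sum_comm]
  rfl

theorem pairing_linForm_mul (c : List (Fin g) → ℝ) (a : Fin g → ℝ) (f : NCPoly g) :
    pairing c (linForm a * f) = ∑ i, a i * pairing (fun w => c (i :: w)) f := by
  simp only [linForm, Finset.sum_mul, map_sum, smul_mul_assoc, map_smul, smul_eq_mul]
  refine Finset.sum_congr rfl fun i _ => ?_
  rw [show FreeAlgebra.ι ℝ i = word [i] by simp, pairing_word_mul]
  rfl

theorem pairing_linForm (c : List (Fin g) → ℝ) (a : Fin g → ℝ) :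
    pairing c (linForm a) = ∑ i, a i * c [i] := by
  simp only [linForm, map_sum, map_smul, smul_eq_mul]
  refine Finset.sum_congr rfl fun i _ => ?_
  rw [show FreeAlgebra.ι ℝ i = word [i] by simp, pairing_word]

theorem pairing_eq_sum_letters {c : List (Fin g) → ℝ} (hc : ∀ w, 2 ≤ w.length → c w = 0)
    {z : NCPoly g} (hz : coeff z [] = 0) : pairing c z = ∑ i, c [i] * coeff z [i] := by
  refine word_induction z ?_ ?_ ?_ ?_
  · simp
  · intro y y' h1 h2
    simp [h1, h2, mul_add, Finset.sum_add_distrib]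
  · intro a y h1
    simp only [map_smul, coeff_smul, h1, Finset.mul_sum, smul_eq_mul, mul_left_comm]
  · intro w hw
    rw [pairing_word]
    match w with
    | [] => exact absurd hz hw
    | [i] =>
      simp only [coeff_word, List.cons.injEq, and_true]
      simp
    | i :: j :: w =>
      rw [hc (i :: j :: w) (by simp)]
      simp only [coeff_word, List.cons.injEq, reduceCtorEq, and_false, if_false, mul_zero,
        Finset.sum_const_zero]

end Forms

/-! ### Isotropic vectors of the Hankel form and the choice of `u`. -/

section Hankel

variable {g : ℕ} {p : NCPoly g}

theorem hankel_comm (hp : IsSelfAdjoint p) (y z : NCPoly g) : hankel p y z = hankel p z y := by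
  rw [hankel, ← pairing_star (coeff_reverse hp), star_mul, star_star, hankel]

theorem hankel_add_smul_self (hp : IsSelfAdjoint p) (z y : NCPoly g) (t : ℝ) :
    hankel p (z + t • y) (z + t • y) =
      hankel p z z + 2 * t * hankel p y z + t * t * hankel p y y := by
  have h : hankel p (z + t • y) (z + t • y) =
      hankel p z z + t * hankel p y z + t * hankel p z y + t * t * hankel p y y := by
    simp only [hankel, star_add, star_smul_real, mul_add, add_mul, smul_mul_assoc, mul_smul_comm,
      map_add, map_smul, smul_eq_mul]
    ring
  rw [h, hankel_comm hp z y]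
  ring

theorem hankel_word_word (v w : List (Fin g)) :
    hankel p (word v) (word w) = coeff p (v.reverse ++ w) := by
  rw [hankel, star_word, ← word_append, pairing_word]

/-- Every word of `star y * z` is longer than the degree of `p`. With `y = z` this is the source of
isotropic vectors. -/
theorem hankel_eq_zero_of_degree_lt {m n : ℕ} {y z : NCPoly g}
    (hy : ∀ w, coeff y w ≠ 0 → m ≤ w.length) (hz : ∀ w, coeff z w ≠ 0 → n ≤ w.length)
    (h : degree p < m + n) : hankel p y z = 0 := by
  refine pairing_eq_zero fun w hw => ?_
  obtain ⟨s, t, rfl, hs, ht⟩ := exists_append_of_coeff_mul_ne_zero hw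
  rw [coeff_star] at hs
  have h1 := hy _ hs
  have h2 := hz _ ht
  apply coeff_eq_zero_of_degree_lt
  rw [List.length_reverse] at h1
  rw [List.length_append]
  omega

theorem eq_zero_of_forall_add_mul_nonneg {a b : ℝ} (h : ∀ t, 0 ≤ a + 2 * t * b) : b = 0 := by
  by_contra hb
  -- This `t` makes the affine function equal to -1.
  have := h (-(a + 1) / (2 * b))
  have e : 2 * (-(a + 1) / (2 * b)) * b = -(a + 1) := by field_simp
  rw [e] at this
  linarith

/-- Along the line `z + t y` the form is affine in `t`, and an affine function bounded below has
slope zero. -/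
theorem hankel_eq_zero_of_isotropic (hp : IsSelfAdjoint p) {y z : NCPoly g}
    (hy : hankel p y y = 0) (h : ∀ t : ℝ, 0 ≤ hankel p (z + t • y) (z + t • y)) :
    hankel p y z = 0 := by
  apply eq_zero_of_forall_add_mul_nonneg (a := hankel p z z)
  intro t
  have := h t
  rwa [hankel_add_smul_self hp, hy, mul_zero, add_zero] at this

theorem le_length_of_coeff_word_ne_zero {v w : List (Fin g)} (h : coeff (word v) w ≠ 0) :
    v.length ≤ w.length := by
  rw [coeff_word] at h
  by_cases h' : v = w
  · rw [h']
  · simp [h'] at h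

theorem exists_smul_unit {v : Fin g → ℝ} (hv : v ≠ 0) :
    ∃ (u : Fin g → ℝ) (s : ℝ), u ⬝ᵥ u = 1 ∧ s ≠ 0 ∧ v = s • u := by
  have hpos : 0 < v ⬝ᵥ v :=
    lt_of_le_of_ne (Finset.sum_nonneg fun i _ => mul_self_nonneg (v i))
      (Ne.symm (mt dotProduct_self_eq_zero.mp hv))
  have hs : Real.sqrt (v ⬝ᵥ v) ≠ 0 := (Real.sqrt_pos.mpr hpos).ne'
  refine ⟨(Real.sqrt (v ⬝ᵥ v))⁻¹ • v, Real.sqrt (v ⬝ᵥ v), ?_, hs, ?_⟩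
  · rw [smul_dotProduct, dotProduct_smul, smul_eq_mul, smul_eq_mul, ← mul_assoc, ← mul_inv,
      Real.mul_self_sqrt hpos.le, inv_mul_cancel₀ hpos.ne']
  · rw [smul_smul, mul_inv_cancel₀ hs, one_smul]

theorem sum_mul_eq_zero_of_eq_smul {u v c : Fin g → ℝ} {s : ℝ} (h : v = s • u)
    (hu : ∑ i, u i * c i = 0) : ∑ i, v i * c i = 0 := by
  simp only [h, Pi.smul_apply, smul_eq_mul, mul_assoc, ← Finset.mul_sum, hu, mul_zero]

/-- If the Hessian has at most one negative square, then its middle matrix at `x = 0` is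
nonnegative on the orthogonal complement of a unit vector that involves only the letters. -/
theorem exists_unit_hankel_nonneg (hg : 1 ≤ g) (hp : IsSelfAdjoint p)
    (h : HasSDS (hessian p) 1) :
    ∃ u : Fin g → ℝ, u ⬝ᵥ u = 1 ∧
      ∀ z, coeff z [] = 0 → ∑ i, u i * coeff z [i] = 0 → 0 ≤ hankel p z z := by
  obtain ⟨β, hβ⟩ := exists_hankel_bound_of_hasSDS_one h
  rcases le_or_gt (degree p) 2 with hd | hd
  · obtain ⟨u, s, hu, hs⟩ : ∃ (u : Fin g → ℝ) (s : ℝ), u ⬝ᵥ u = 1 ∧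
        (fun i => β (FreeAlgebra.ι ℝ i)) = s • u := by
      -- In degree at most two, `u` is the direction of `β` on the letters. If `β` vanishes there,
      -- any unit vector serves, and one exists because there is a variable.
      by_cases hb : (fun i => β (FreeAlgebra.ι ℝ i)) = 0
      · exact ⟨Pi.single ⟨0, hg⟩ 1, 0, by simp, by simp [hb]⟩
      · obtain ⟨u, s, hu, _, hs⟩ := exists_smul_unit hb
        exact ⟨u, s, hu, hs⟩
    refine ⟨u, hu, fun z hz huz => ?_⟩
    -- Only the letter part `y` of `z` is visible to the form, since all other products of words
    -- have length at least three.
    set y := linForm fun i => coeff z [i]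
    have hy : ∀ w, coeff y w ≠ 0 → 1 ≤ w.length := fun w hw =>
      (isHomogeneous_linForm _ w hw).ge
    have hr : ∀ w, coeff (z - y) w ≠ 0 → 2 ≤ w.length := by
      intro w hw
      match w with
      | [] =>
        refine absurd ?_ hw
        rw [coeff_sub, hz, (isHomogeneous_linForm _).coeff_eq_zero (by simp), sub_zero]
      | [i] =>
        refine absurd ?_ hw
        rw [coeff_sub, coeff_linForm, sub_self]
      | i :: j :: w => simp
    have hz' : z = y + (1 : ℝ) • (z - y) := by simp
    have hyz : hankel p z z = hankel p y y := by
      conv_lhs => rw [hz']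
      rw [hankel_add_smul_self hp, hankel_eq_zero_of_degree_lt hr hy (by omega),
        hankel_eq_zero_of_degree_lt hr hr (by omega)]
      ring
    have hβy : β y = 0 := by
      have := sum_mul_eq_zero_of_eq_smul hs huz
      simp only [y, linForm, map_sum, map_smul, smul_eq_mul]
      rw [← this]
      exact Finset.sum_congr rfl fun i _ => mul_comm _ _
    have := hβ y ((isHomogeneous_linForm _).coeff_eq_zero (by simp))
    rw [hβy] at this
    rw [hyz]
    linarith
  · obtain ⟨w₀, hw₀, hc⟩ := exists_coeff_ne_zero_of_degree_pos (p := p) (by omega)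
    obtain ⟨v, k, rfl⟩ : ∃ v k, w₀ = v ++ [k] := by
      rcases List.eq_nil_or_concat w₀ with h | ⟨v, k, h⟩
      · simp [h] at hw₀
        omega
      · exact ⟨v, k, by simpa using h⟩
    simp only [List.length_append, List.length_singleton] at hw₀
    -- For a top word `v k` of length at least three, the reversal of `v` is isotropic, and its
    -- pairing with `z` sees only the letters of `z`: longer words exceed the degree.
    have hlen : ∀ w, coeff (word v.reverse) w ≠ 0 → v.length ≤ w.length := fun w hw => by
      simpa using le_length_of_coeff_word_ne_zero hw
    have hyy : hankel p (word v.reverse) (word v.reverse) = 0 :=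
      hankel_eq_zero_of_degree_lt hlen hlen (by omega)
    have hyz : ∀ z, coeff z [] = 0 → hankel p (word v.reverse) z =
        ∑ i, coeff p (v ++ [i]) * coeff z [i] := by
      intro z hz
      rw [hankel, star_word, List.reverse_reverse, pairing_word_mul]
      refine pairing_eq_sum_letters (fun w hw => coeff_eq_zero_of_degree_lt ?_) hz
      rw [List.length_append]
      omega
    have hy0 : coeff (word v.reverse) [] = 0 := by
      by_contra hne
      have := hlen _ hne
      simp at this
      simp [this] at hw₀
      omega
    -- If `β` killed the isotropic word, that word would be orthogonal to the letter `k`, although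
    -- their pairing is the nonzero coefficient of `v k`.
    have hβy : β (word v.reverse) ≠ 0 := by
      intro hβy
      have hz : coeff (word [k]) [] = 0 := by
        simp only [coeff_word, reduceCtorEq, if_false]
      have : 2 * hankel p (word v.reverse) (word [k]) = 0 := by
        apply eq_zero_of_forall_add_mul_nonneg
          (a := 2 * hankel p (word [k]) (word [k]) + β (word [k]) * β (word [k]))
        intro t
        have := hβ (word [k] + t • word v.reverse) (by
          simp only [coeff_add, coeff_smul, hz, hy0, mul_zero, add_zero])
        rw [hankel_add_smul_self hp, hyy, map_add, map_smul, hβy] at this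
        simp only [smul_zero, add_zero, mul_zero] at this
        linarith
      rw [hankel_word_word, List.reverse_reverse] at this
      exact hc (by linarith)
    obtain ⟨u, s, hu, _, hs⟩ := exists_smul_unit (v := fun i => coeff p (v ++ [i]))
      (fun h0 => hc (congrFun h0 k))
    refine ⟨u, hu, fun z hz huz => ?_⟩
    have hyz0 : hankel p (word v.reverse) z = 0 := by
      rw [hyz z hz]
      exact sum_mul_eq_zero_of_eq_smul hs huz
    -- For `z` orthogonal to `u`, moving along the isotropic word leaves the form unchanged; the
    -- multiple is chosen so that `β` vanishes.
    have := hβ (z + (-(β z) / β (word v.reverse)) • word v.reverse) (by simp [hz, hy0])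
    have hβ0 : β (z + (-(β z) / β (word v.reverse)) • word v.reverse) = 0 := by
      rw [map_add, map_smul, smul_eq_mul, div_mul_cancel₀ _ hβy, add_neg_cancel]
    rw [hβ0, hankel_add_smul_self hp, hyy, hyz0] at this
    linarith

end Hankel

/-! ### The block matrix `E₂` and Gram factorizations. -/

section BlockMatrix

variable {g : ℕ}

theorem projPerp_transpose (u : Fin g → ℝ) : (projPerp u)ᵀ = projPerp u := by
  ext i j
  simp [projPerp, Matrix.vecMulVec_apply, Matrix.one_apply, eq_comm, mul_comm]

theorem projPerp_mulVec (u c : Fin g → ℝ) : projPerp u *ᵥ c = c - (u ⬝ᵥ c) • u := by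
  rw [projPerp, Matrix.sub_mulVec, Matrix.one_mulVec, Matrix.vecMulVec_mulVec]
  simp

theorem dotProduct_projPerp_mulVec {u : Fin g → ℝ} (hu : u ⬝ᵥ u = 1) (c : Fin g → ℝ) :
    u ⬝ᵥ projPerp u *ᵥ c = 0 := by
  rw [projPerp_mulVec, dotProduct_sub, dotProduct_smul, hu, smul_eq_mul, mul_one, sub_self]

theorem blockE_quadratic (p₂ q f₀ : NCPoly g) (u : Fin g → ℝ) (x : Fin g ⊕ Fin g → ℝ) :
    x ⬝ᵥ blockE p₂ u q f₀ *ᵥ x =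
      (projPerp u *ᵥ (x ∘ Sum.inl)) ⬝ᵥ quadMatrix p₂ *ᵥ (projPerp u *ᵥ (x ∘ Sum.inl)) +
        2 * ((x ∘ Sum.inr) ⬝ᵥ quadMatrix q *ᵥ (projPerp u *ᵥ (x ∘ Sum.inl))) +
          (x ∘ Sum.inr) ⬝ᵥ quadMatrix f₀ *ᵥ (x ∘ Sum.inr) := by
  have hP : ∀ v : Fin g → ℝ, (x ∘ Sum.inl) ⬝ᵥ projPerp u *ᵥ v =
      (projPerp u *ᵥ (x ∘ Sum.inl)) ⬝ᵥ v := fun v => by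
    rw [Matrix.dotProduct_mulVec, ← Matrix.mulVec_transpose, projPerp_transpose]
  have hQ : (projPerp u *ᵥ (x ∘ Sum.inl)) ⬝ᵥ (quadMatrix q)ᵀ *ᵥ (x ∘ Sum.inr) =
      (x ∘ Sum.inr) ⬝ᵥ quadMatrix q *ᵥ (projPerp u *ᵥ (x ∘ Sum.inl)) := by
    rw [Matrix.mulVec_transpose, dotProduct_comm, ← Matrix.dotProduct_mulVec]
  conv_lhs => rw [← Sum.elim_comp_inl_inr x]
  rw [blockE, Matrix.fromBlocks_mulVec, sumElim_dotProduct_sumElim]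
  simp only [Sum.elim_comp_inl, Sum.elim_comp_inr, dotProduct_add, ← Matrix.mulVec_mulVec, hP, hQ]
  ring

theorem isHermitian_blockE {p₂ q f₀ : NCPoly g} {u : Fin g → ℝ}
    (h₂ : (quadMatrix p₂)ᵀ = quadMatrix p₂) (h₀ : (quadMatrix f₀)ᵀ = quadMatrix f₀) :
    (blockE p₂ u q f₀).IsHermitian := by
  apply Matrix.IsHermitian.fromBlocks
  · rw [Matrix.IsHermitian, Matrix.conjTranspose_eq_transpose_of_trivial, Matrix.transpose_mul,
      Matrix.transpose_mul, projPerp_transpose, h₂, Matrix.mul_assoc]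
  · rw [Matrix.conjTranspose_eq_transpose_of_trivial, Matrix.transpose_mul,
      Matrix.transpose_transpose, projPerp_transpose]
  · rw [Matrix.IsHermitian, Matrix.conjTranspose_eq_transpose_of_trivial, h₀]

open scoped MatrixOrder in
theorem exists_eq_transpose_mul_self {ι : Type*} [Fintype ι] {A : Matrix ι ι ℝ}
    (hA : A.PosSemidef) : ∃ B : Matrix ι ι ℝ, A = Bᵀ * B := by
  classical
  obtain ⟨B, hB⟩ := CStarAlgebra.nonneg_iff_eq_star_mul_self.mp hA.nonneg
  exact ⟨B, by rw [hB, Matrix.star_eq_conjTranspose, Matrix.conjTranspose_eq_transpose_of_trivial]⟩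

/-- Turns a Gram factorization of a real matrix into a sum of products in an algebra whose elements
need not commute. -/
theorem sum_transpose_mul_self_smul {ι A : Type*} [Fintype ι] [Ring A] [Algebra ℝ A]
    (B : Matrix ι ι ℝ) (v w : ι → A) :
    ∑ i, ∑ j, (Bᵀ * B) i j • (v i * w j) = ∑ r, (∑ i, B r i • v i) * ∑ j, B r j • w j := by
  simp only [Matrix.mul_apply, Matrix.transpose_apply, Finset.sum_mul_sum, Finset.sum_smul,
    smul_mul_smul_comm]
  rw [Finset.sum_comm_cycle]

end BlockMatrix

/-! ### Homogeneous parts and contraction with linear forms. -/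

section Contraction

variable {g : ℕ}

theorem IsHomogeneous.mul {p q : NCPoly g} {m n : ℕ} (hp : IsHomogeneous p m)
    (hq : IsHomogeneous q n) : IsHomogeneous (p * q) (m + n) := by
  intro w hw
  obtain ⟨s, t, rfl, hs, ht⟩ := exists_append_of_coeff_mul_ne_zero hw
  rw [List.length_append, hp s hs, hq t ht]

theorem IsHomogeneous.star {p : NCPoly g} {m : ℕ} (hp : IsHomogeneous p m) :
    IsHomogeneous (star p) m := by
  intro w hw
  rw [coeff_star] at hw
  rw [← hp _ hw, List.length_reverse]

theorem isHomogeneous_homogeneousPart (p : NCPoly g) (k : ℕ) :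
    IsHomogeneous (homogeneousPart p k) k := by
  intro w hw
  rw [coeff_homogeneousPart] at hw
  by_contra h
  exact hw (if_neg h)

theorem isSelfAdjoint_homogeneousPart {p : NCPoly g} (hp : IsSelfAdjoint p) (k : ℕ) :
    IsSelfAdjoint (homogeneousPart p k) := by
  apply ext_coeff
  intro w
  rw [coeff_star, coeff_homogeneousPart, coeff_homogeneousPart, List.length_reverse,
    coeff_reverse hp]

theorem quadMatrix_transpose {p : NCPoly g} (hp : IsSelfAdjoint p) :
    (quadMatrix p)ᵀ = quadMatrix p := by
  ext i j
  exact coeff_reverse hp [i, j]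

theorem quadMatrix_homogeneousPart (p : NCPoly g) :
    quadMatrix (homogeneousPart p 2) = quadMatrix p := by
  ext i j
  simp [quadMatrix, coeff_homogeneousPart]

theorem pairing_linForm_mul' (c : List (Fin g) → ℝ) (a : Fin g → ℝ) (f : NCPoly g) :
    pairing c (linForm a * f) = pairing (fun w => ∑ i, a i * c (i :: w)) f := by
  refine word_induction f ?_ ?_ ?_ ?_
  · simp
  · intro y y' h1 h2
    rw [mul_add, map_add, map_add, h1, h2]
  · intro r y h1
    rw [mul_smul_comm, map_smul, map_smul, h1]
  · intro w _
    simp [pairing_linForm_mul]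

theorem pairing_mul_linForm (c : List (Fin g) → ℝ) (a : Fin g → ℝ) (f : NCPoly g) :
    pairing c (f * linForm a) = pairing (fun w => ∑ i, a i * c (w ++ [i])) f := by
  refine word_induction f ?_ ?_ ?_ ?_
  · simp
  · intro y y' h1 h2
    rw [add_mul, map_add, map_add, h1, h2]
  · intro r y h1
    rw [smul_mul_assoc, map_smul, map_smul, h1]
  · intro w _
    rw [pairing_word_mul, pairing_linForm, pairing_word]

theorem pairing_linForm_mul_linForm (c : List (Fin g) → ℝ) (a b : Fin g → ℝ) :
    pairing c (linForm a * linForm b) = a ⬝ᵥ (Matrix.of fun i j => c [i, j]) *ᵥ b := by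
  rw [pairing_linForm_mul]
  refine Finset.sum_congr rfl fun i _ => ?_
  rw [pairing_linForm]
  congr 1
  exact Finset.sum_congr rfl fun j _ => mul_comm _ _

/-- Test with the projection of the `i`-th basis vector to the complement of `u`. -/
theorem eq_smul_of_forall_orthogonal {u f : Fin g → ℝ} (hu : u ⬝ᵥ u = 1)
    (h : ∀ c : Fin g → ℝ, u ⬝ᵥ c = 0 → c ⬝ᵥ f = 0) (i : Fin g) : f i = (u ⬝ᵥ f) * u i := by
  have := h (Pi.single i 1 - u i • u) (by
    rw [dotProduct_sub, dotProduct_smul, hu]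
    simp)
  rw [sub_dotProduct, smul_dotProduct, single_dotProduct, smul_eq_mul, one_mul] at this
  linarith

end Contraction

/-! ### From positivity on a hyperplane to the representation. -/

section Positivity

variable {g : ℕ} {p : NCPoly g}

theorem coeff_eq_zero_of_length_lt {n : ℕ} {z : NCPoly g}
    (hz : ∀ w, coeff z w ≠ 0 → n ≤ w.length) {w : List (Fin g)} (hw : w.length < n) :
    coeff z w = 0 :=
  not_not.mp fun h => absurd (hz w h) (not_le.mpr hw)

/-- If the middle matrix at `x = 0` is nonnegative on the polynomials without words of length
less than `k`, then the degree is at most `2 k`. -/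
theorem degree_le_two_mul (hp : IsSelfAdjoint p) {k : ℕ}
    (h : ∀ z, (∀ w, coeff z w ≠ 0 → k ≤ w.length) → 0 ≤ hankel p z z) : degree p ≤ 2 * k := by
  by_contra! hd
  obtain ⟨w, hw, hc⟩ := exists_coeff_ne_zero_of_degree_pos (p := p) (by omega)
  set y : NCPoly g := word (w.take (degree p - k)).reverse
  set z : NCPoly g := word (w.drop (degree p - k))
  -- A top word of length `d > 2k` is cut into pieces of lengths `d - k` and `k`. The first is
  -- isotropic because `2 (d - k) > d`, so the coefficient of the word vanishes.
  have hy : ∀ w, coeff y w ≠ 0 → degree p - k ≤ w.length := fun v hv => by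
    have := le_length_of_coeff_word_ne_zero hv
    simp at this
    omega
  have hz : ∀ w, coeff z w ≠ 0 → k ≤ w.length := fun v hv => by
    have := le_length_of_coeff_word_ne_zero hv
    simp at this
    omega
  have hyz : hankel p y z = 0 := by
    apply hankel_eq_zero_of_isotropic hp (hankel_eq_zero_of_degree_lt hy hy (by omega))
    intro t
    apply h
    intro v hv
    by_contra! hlt
    rw [coeff_add, coeff_smul, coeff_eq_zero_of_length_lt hy (by omega),
      coeff_eq_zero_of_length_lt hz hlt] at hv
    simp at hv
  rw [hankel_word_word, List.reverse_reverse, List.take_append_drop] at hyz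
  exact hc hyz

variable {u : Fin g → ℝ}
  (hu : u ⬝ᵥ u = 1) (hp : IsSelfAdjoint p)
  (h : ∀ z, coeff z [] = 0 → ∑ i, u i * coeff z [i] = 0 → 0 ≤ hankel p z z)

include hp h

/-- A polynomial without words of length below two satisfies the orthogonality to `u` trivially. -/
theorem degree_le_four : degree p ≤ 4 := by
  apply degree_le_two_mul (k := 2) hp
  intro z hz
  apply h z (coeff_eq_zero_of_length_lt hz (by simp))
  exact Finset.sum_eq_zero fun i _ => by rw [coeff_eq_zero_of_length_lt hz (by simp), mul_zero]

theorem hankel_linForm_eq_zero {y : NCPoly g} (hy : ∀ w, coeff y w ≠ 0 → 2 ≤ w.length)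
    (hyy : hankel p y y = 0) {c : Fin g → ℝ} (hc : u ⬝ᵥ c = 0) :
    hankel p y (linForm c) = 0 := by
  apply hankel_eq_zero_of_isotropic hp hyy
  intro t
  apply h
  · rw [coeff_add, coeff_smul, coeff_eq_zero_of_length_lt hy (by simp),
      (isHomogeneous_linForm c).coeff_eq_zero (by simp), mul_zero, add_zero]
  · rw [← hc]
    refine Finset.sum_congr rfl fun i _ => ?_
    rw [coeff_add, coeff_smul, coeff_eq_zero_of_length_lt hy (by simp), coeff_linForm, mul_zero,
      add_zero]

/-- A word of length three is isotropic, since six exceeds the degree bound four, so it is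
orthogonal to every linear form in the complement of `u`. -/
theorem dotProduct_quartic_eq_zero {s : List (Fin g)} (hs : s.length = 3) {c : Fin g → ℝ}
    (hc : u ⬝ᵥ c = 0) : c ⬝ᵥ (fun i => coeff p (s ++ [i])) = 0 := by
  have hy : ∀ w, coeff (word s.reverse) w ≠ 0 → 3 ≤ w.length := fun w hw => by
    simpa [hs] using le_length_of_coeff_word_ne_zero hw
  have h4 := degree_le_four hp h
  have := hankel_linForm_eq_zero hp h (fun w hw => le_trans (by norm_num) (hy w hw))
    (hankel_eq_zero_of_degree_lt hy hy (by omega)) hc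
  rwa [hankel, star_word, List.reverse_reverse, pairing_word_mul, pairing_linForm] at this

/-- The polynomial `xⱼ e` is isotropic: its square `e xⱼ xⱼ e` involves only quartic coefficients
contracted at the end with a vector orthogonal to `u`. It is therefore orthogonal to the linear form
of `c`. -/
theorem dotProduct_cubic_eq_zero (j : Fin g) {e c : Fin g → ℝ} (he : u ⬝ᵥ e = 0)
    (hc : u ⬝ᵥ c = 0) : e ⬝ᵥ (fun k => c ⬝ᵥ fun i => coeff p [k, j, i]) = 0 := by
  have hy : ∀ w, coeff (word [j] * linForm e) w ≠ 0 → 2 ≤ w.length := fun w hw => by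
    obtain ⟨s, t, rfl, hs, ht⟩ := exists_append_of_coeff_mul_ne_zero hw
    have h1 := le_length_of_coeff_word_ne_zero hs
    have h2 := isHomogeneous_linForm _ _ ht
    simp at h1 ⊢
    omega
  have hyy : hankel p (word [j] * linForm e) (word [j] * linForm e) = 0 := by
    rw [hankel, star_mul, star_linForm, star_word, mul_assoc, pairing_linForm_mul]
    refine Finset.sum_eq_zero fun k _ => ?_
    rw [pairing_word_mul, pairing_word_mul, pairing_linForm]
    have := dotProduct_quartic_eq_zero hp h (s := [k, j, j]) rfl he
    exact mul_eq_zero_of_right _ this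
  have := hankel_linForm_eq_zero hp h hy hyy hc
  rw [hankel, star_mul, star_linForm, star_word, mul_assoc, pairing_linForm_mul] at this
  rw [← this]
  refine Finset.sum_congr rfl fun k _ => ?_
  rw [pairing_word_mul, pairing_linForm]
  rfl

include hu

/-- The last letter contributes a factor from `u`; by the symmetry of `p`, so does the first. -/
theorem coeff_quartic (i j k l : Fin g) :
    coeff p [i, j, k, l] = u i * (∑ b, u b * ∑ a, u a * coeff p [a, j, k, b]) * u l := by
  have h1 : ∀ i j k l, coeff p [i, j, k, l] = (∑ b, u b * coeff p [i, j, k, b]) * u l :=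
    fun i j k l => eq_smul_of_forall_orthogonal hu
      (fun c hc => dotProduct_quartic_eq_zero hp h (s := [i, j, k]) rfl hc) l
  have hr : ∀ i j k l, coeff p [i, j, k, l] = coeff p [l, k, j, i] :=
    fun i j k l => coeff_reverse hp [l, k, j, i]
  have h2 : ∀ b, coeff p [i, j, k, b] = (∑ a, u a * coeff p [a, j, k, b]) * u i := fun b => by
    rw [hr, h1]
    simp only [hr b]
  rw [h1]
  simp only [h2 _, ← mul_assoc, ← Finset.sum_mul]
  ring

/-- For a fixed middle letter, the matrix in the outer letters vanishes on the complement of `u` in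
both arguments. So it is a sum of a part with row direction `u` and one with column direction `u`,
less the overlap counted twice. -/
theorem coeff_cubic (k j i : Fin g) :
    coeff p [k, j, i] = u k * (∑ a, u a * coeff p [a, j, i]) +
      (∑ a, u a * coeff p [a, j, k]) * u i -
        u k * (∑ b, u b * ∑ a, u a * coeff p [a, j, b]) * u i := by
  have hr : ∀ i j k, coeff p [i, j, k] = coeff p [k, j, i] :=
    fun i j k => coeff_reverse hp [k, j, i]
  have h1 : ∀ e : Fin g → ℝ, u ⬝ᵥ e = 0 →
      e ⬝ᵥ (fun k => coeff p [k, j, i] - (∑ a, u a * coeff p [a, j, k]) * u i) = 0 := by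
    intro e he
    have hc : u ⬝ᵥ (Pi.single i 1 - u i • u) = 0 := by
      rw [dotProduct_sub, dotProduct_smul, hu]
      simp
    rw [← dotProduct_cubic_eq_zero hp h j he hc]
    congr 1
    ext k
    rw [sub_dotProduct, smul_dotProduct, single_dotProduct, smul_eq_mul, one_mul, mul_comm]
    simp only [dotProduct, hr k j]
  have h2 := eq_smul_of_forall_orthogonal hu h1 k
  have h3 : u ⬝ᵥ (fun k => coeff p [k, j, i] - (∑ a, u a * coeff p [a, j, k]) * u i) =
      ∑ a, u a * coeff p [a, j, i] - (∑ b, u b * ∑ a, u a * coeff p [a, j, b]) * u i := by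
    simp only [dotProduct, mul_sub, Finset.sum_sub_distrib, ← mul_assoc, ← Finset.sum_mul]
  rw [h3] at h2
  linarith

theorem exists_isRepresentation :
    ∃ (p₀ p₁ p₂ : NCPoly g) (u : Fin g → ℝ) (q f₀ : NCPoly g),
      IsRepresentation p p₀ p₁ p₂ u q f₀ := by
  set S : Matrix (Fin g) (Fin g) ℝ := .of fun j k => ∑ a, u a * coeff p [a, j, k] with hS
  set R : Fin g → ℝ := S *ᵥ u with hR
  -- The overlap `uₖ Rⱼ uᵢ` is contained in both `φ q` and its adjoint, so half of it is removed
  -- from `q`.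
  set Q : Matrix (Fin g) (Fin g) ℝ := S - (1 / 2 : ℝ) • Matrix.vecMulVec R u with hQ
  set F : Matrix (Fin g) (Fin g) ℝ :=
    .of fun j k => ∑ b, u b * ∑ a, u a * coeff p [a, j, k, b] with hF
  have hφ := isHomogeneous_linForm u
  have hq := isHomogeneous_quadForm Q
  have hf := isHomogeneous_quadForm F
  have h0 := isHomogeneous_homogeneousPart p 0
  have h1 := isHomogeneous_homogeneousPart p 1
  have h2 := isHomogeneous_homogeneousPart p 2
  have h3 := hφ.mul hq
  have h3' := hq.star.mul hφ
  have h4 := (hφ.mul hf).mul hφ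
  refine ⟨homogeneousPart p 0, homogeneousPart p 1, homogeneousPart p 2, u, quadForm Q,
    quadForm F, isSelfAdjoint_homogeneousPart hp 0, isSelfAdjoint_homogeneousPart hp 1,
    isSelfAdjoint_homogeneousPart hp 2, h0, h1, h2, hu, hq, hf, ?_, ?_⟩
  · apply ext_coeff
    intro w
    simp only [coeff_add]
    match w with
    | [] =>
      rw [h1.coeff_eq_zero (by simp), h2.coeff_eq_zero (by simp), h3.coeff_eq_zero (by simp),
        h3'.coeff_eq_zero (by simp), h4.coeff_eq_zero (by simp), coeff_homogeneousPart]
      simp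
    | [i] =>
      rw [h0.coeff_eq_zero (by simp), h2.coeff_eq_zero (by simp), h3.coeff_eq_zero (by simp),
        h3'.coeff_eq_zero (by simp), h4.coeff_eq_zero (by simp), coeff_homogeneousPart]
      simp
    | [i, j] =>
      rw [h0.coeff_eq_zero (by simp), h1.coeff_eq_zero (by simp), h3.coeff_eq_zero (by simp),
        h3'.coeff_eq_zero (by simp), h4.coeff_eq_zero (by simp), coeff_homogeneousPart]
      simp
    | [k, j, i] =>
      rw [h0.coeff_eq_zero (by simp), h1.coeff_eq_zero (by simp), h2.coeff_eq_zero (by simp),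
        h4.coeff_eq_zero (by simp), coeff_linForm_mul_cons, coeff_quadForm,
        show [k, j, i] = [k, j] ++ [i] from rfl, coeff_mul_linForm_append, star_quadForm,
        coeff_quadForm]
      rw [show [k, j] ++ [i] = [k, j, i] from rfl, coeff_cubic hu hp h k j i]
      have hRj : R j = ∑ b, u b * ∑ a, u a * coeff p [a, j, b] := by
        simp only [hR, Matrix.mulVec, dotProduct, hS, Matrix.of_apply]
        exact Finset.sum_congr rfl fun b _ => mul_comm _ _
      simp only [hQ, Matrix.sub_apply, Matrix.smul_apply, Matrix.transpose_apply,
        Matrix.vecMulVec_apply, hRj, hS, Matrix.of_apply, smul_eq_mul]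
      ring
    | [i, j, k, l] =>
      rw [h0.coeff_eq_zero (by simp), h1.coeff_eq_zero (by simp), h2.coeff_eq_zero (by simp),
        h3.coeff_eq_zero (by simp), h3'.coeff_eq_zero (by simp),
        show [i, j, k, l] = [i, j, k] ++ [l] from rfl, coeff_mul_linForm_append,
        coeff_linForm_mul_cons, coeff_quadForm]
      rw [show [i, j, k] ++ [l] = [i, j, k, l] from rfl, coeff_quartic hu hp h i j k l]
      simp [hF]
    | a :: b :: c :: d :: e :: w =>
      have hd := degree_le_four hp h
      rw [h0.coeff_eq_zero (by simp), h1.coeff_eq_zero (by simp), h2.coeff_eq_zero (by simp),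
        h3.coeff_eq_zero (by simp), h3'.coeff_eq_zero (by simp), h4.coeff_eq_zero (by simp),
        coeff_eq_zero_of_degree_lt (by simp; omega)]
      simp
  · have hFs : Fᵀ = F := by
      ext j k
      simp only [hF, Matrix.transpose_apply, Matrix.of_apply, Finset.mul_sum]
      rw [Finset.sum_comm]
      refine Finset.sum_congr rfl fun a _ => Finset.sum_congr rfl fun b _ => ?_
      rw [mul_left_comm, ← coeff_reverse hp [b, j, k, a]]
      rfl
    apply Matrix.PosSemidef.of_dotProduct_mulVec_nonneg
    · apply isHermitian_blockE (quadMatrix_transpose (isSelfAdjoint_homogeneousPart hp 2))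
      rw [quadMatrix_quadForm, hFs]
    intro x
    rw [star_trivial, blockE_quadratic, quadMatrix_homogeneousPart, quadMatrix_quadForm,
      quadMatrix_quadForm]
    set e := projPerp u *ᵥ (x ∘ Sum.inl)
    set d := x ∘ Sum.inr
    have hue : u ⬝ᵥ e = 0 := dotProduct_projPerp_mulVec hu _
    have hQe : Q *ᵥ e = S *ᵥ e := by
      rw [hQ, Matrix.sub_mulVec, Matrix.smul_mulVec, Matrix.vecMulVec_mulVec, hue]
      simp
    -- The words of `d φ` have length two, so the condition on the letters concerns `e` alone.
    have hpos := h (linForm e + linForm d * linForm u)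
      (by simp [(isHomogeneous_linForm e).coeff_eq_zero]) (by
        rw [← hue]
        refine Finset.sum_congr rfl fun i _ => ?_
        rw [coeff_add, coeff_linForm, coeff_linForm_mul_cons, hφ.coeff_eq_zero (by simp)]
        simp)
    have hexp : hankel p (linForm e + linForm d * linForm u) (linForm e + linForm d * linForm u) =
        pairing (coeff p) (linForm e * linForm e) +
          2 * pairing (coeff p) (linForm u * (linForm d * linForm e)) +
            pairing (coeff p) (linForm u * (linForm d * linForm d * linForm u)) := by
      have hs : pairing (coeff p) (linForm e * (linForm d * linForm u)) =
          pairing (coeff p) (linForm u * (linForm d * linForm e)) := by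
        rw [← pairing_star (coeff_reverse hp)]
        simp only [star_mul, star_linForm, mul_assoc]
      rw [hankel, star_add, star_mul, star_linForm, star_linForm, star_linForm, add_mul, mul_add,
        mul_add, map_add, map_add, map_add, hs]
      simp only [mul_assoc]
      ring
    rw [hexp, pairing_linForm_mul_linForm, pairing_linForm_mul', pairing_linForm_mul_linForm,
      pairing_linForm_mul', pairing_mul_linForm, pairing_linForm_mul_linForm] at hpos
    rw [hQe]
    exact hpos

end Positivity

/-! ### Matrix positivity of quadratic forms and the case without negative squares. -/

/-- A Gram factorization writes `q` as a sum of squares of linear forms, whose values at symmetric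
matrices are symmetric. -/
theorem matrixPositive_of_posSemidef {g : ℕ} {q : NCPoly g} (hq : IsHomogeneous q 2)
    (h : (quadMatrix q).PosSemidef) : MatrixPositive q := by
  intro n X hX
  obtain ⟨B, hB⟩ := exists_eq_transpose_mul_self h
  have e : FreeAlgebra.lift ℝ X q = ∑ r, (∑ i, B r i • X i) * ∑ j, B r j • X j := by
    rw [← sum_transpose_mul_self_smul, ← hB, ← quadForm_quadMatrix hq, quadMatrix_quadForm]
    simp [quadForm]
  rw [e]
  refine Matrix.posSemidef_sum _ fun r _ => ?_
  have hs : (∑ i, B r i • X i)ᴴ = ∑ i, B r i • X i := by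
    rw [Matrix.conjTranspose_eq_transpose_of_trivial, Matrix.transpose_sum]
    exact Finset.sum_congr rfl fun i _ => by rw [Matrix.transpose_smul, (hX i).eq]
  have := Matrix.posSemidef_conjTranspose_mul_self (∑ i, B r i • X i)
  rwa [hs] at this

/-- Matrices of size one already recover the real quadratic form. -/
theorem posSemidef_of_matrixPositive {g : ℕ} {q : NCPoly g} (hq : IsHomogeneous q 2)
    (hs : IsSelfAdjoint q) (h : MatrixPositive q) : (quadMatrix q).PosSemidef := by
  apply Matrix.PosSemidef.of_dotProduct_mulVec_nonneg
  · rw [Matrix.IsHermitian, Matrix.conjTranspose_eq_transpose_of_trivial, quadMatrix_transpose hs]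
  intro x
  have := (h 1 (fun i => Matrix.diagonal fun _ => x i)
    (fun j => Matrix.isSymm_diagonal _)).diag_nonneg (i := 0)
  rw [← quadForm_quadMatrix hq] at this
  simp [quadForm, Matrix.sum_apply] at this
  rw [star_trivial]
  refine this.trans_eq ?_
  refine Finset.sum_congr rfl fun i _ => ?_
  simp only [Matrix.mulVec, dotProduct, Finset.mul_sum]
  exact Finset.sum_congr rfl fun j _ => by ring

theorem degree_le_two_and_matrixPositive {g : ℕ} {p : NCPoly g} (hp : IsSelfAdjoint p)
    (h : HasSDS (hessian p) 0) :
    degree p ≤ 2 ∧ MatrixPositive (homogeneousPart p 2) := by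
  constructor
  · exact degree_le_two_mul (k := 1) hp fun z hz =>
      hankel_nonneg_of_hasSDS_zero h (coeff_eq_zero_of_length_lt hz (by simp))
  · apply matrixPositive_of_posSemidef (isHomogeneous_homogeneousPart p 2)
    rw [quadMatrix_homogeneousPart]
    apply Matrix.PosSemidef.of_dotProduct_mulVec_nonneg
    · rw [Matrix.IsHermitian, Matrix.conjTranspose_eq_transpose_of_trivial,
        quadMatrix_transpose hp]
    intro x
    have := hankel_nonneg_of_hasSDS_zero h (z := linForm x)
      ((isHomogeneous_linForm x).coeff_eq_zero (by simp))
    rwa [hankel, star_linForm, pairing_linForm_mul_linForm] at this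

/-! ### Degree in `h` and Taylor coefficients. -/

section HDegree

variable {g : ℕ}

/-- `f(x)[h]` is `0` or homogeneous of degree `n` in `h`. -/
def IsHomogeneousInH (f : NCPolyXH g) (n : ℕ) : Prop :=
  ∀ w : List (Fin g ⊕ Fin g), coeff f w ≠ 0 → w.countP Sum.isRight = n

theorem IsHomogeneousInH.add {f f' : NCPolyXH g} {n : ℕ} (hf : IsHomogeneousInH f n)
    (hf' : IsHomogeneousInH f' n) : IsHomogeneousInH (f + f') n := by
  intro w hw
  by_contra h
  rw [coeff_add, not_not.mp (mt (hf w) h), not_not.mp (mt (hf' w) h), add_zero] at hw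
  exact hw rfl

theorem IsHomogeneousInH.smul {f : NCPolyXH g} {n : ℕ} (hf : IsHomogeneousInH f n) (c : ℝ) :
    IsHomogeneousInH (c • f) n := by
  intro w hw
  rw [coeff_smul] at hw
  exact hf w (right_ne_zero_of_mul hw)

theorem IsHomogeneousInH.sub {f f' : NCPolyXH g} {n : ℕ} (hf : IsHomogeneousInH f n)
    (hf' : IsHomogeneousInH f' n) : IsHomogeneousInH (f - f') n := by
  rw [sub_eq_add_neg, ← neg_one_smul ℝ f']
  exact hf.add (hf'.smul _)

theorem isHomogeneousInH_zero (n : ℕ) : IsHomogeneousInH (0 : NCPolyXH g) n :=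
  fun w hw => absurd (coeff_zero w) hw

theorem IsHomogeneousInH.sum {ι : Type*} (s : Finset ι) {f : ι → NCPolyXH g} {n : ℕ}
    (hf : ∀ i ∈ s, IsHomogeneousInH (f i) n) : IsHomogeneousInH (∑ i ∈ s, f i) n :=
  Finset.sum_induction f (IsHomogeneousInH · n) (fun _ _ => IsHomogeneousInH.add)
    (isHomogeneousInH_zero n) hf

theorem IsHomogeneousInH.mul {f f' : NCPolyXH g} {m n : ℕ} (hf : IsHomogeneousInH f m)
    (hf' : IsHomogeneousInH f' n) : IsHomogeneousInH (f * f') (m + n) := by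
  intro w hw
  obtain ⟨s, t, rfl, hs, ht⟩ := exists_append_of_coeff_mul_ne_zero hw
  rw [List.countP_append, hf s hs, hf' t ht]

theorem isHomogeneousInH_taylor (n : ℕ) (p : NCPoly g) : IsHomogeneousInH (taylor n p) n := by
  intro w hw
  rw [coeff_taylor] at hw
  by_contra h
  exact hw (if_neg h)

theorem star_taylor (n : ℕ) (p : NCPoly g) : star (taylor n p) = taylor n (star p) := by
  apply ext_coeff
  intro w
  rw [coeff_star, coeff_taylor, coeff_taylor, coeff_star, List.countP_reverse]
  simp [forget]

theorem taylor_two_congr {p q : NCPoly g} (h : ∀ w : List (Fin g), 2 ≤ w.length →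
    coeff p w = coeff q w) : taylor 2 p = taylor 2 q := by
  apply ext_coeff
  intro w
  rw [coeff_taylor, coeff_taylor]
  split_ifs with hw
  · apply h
    rw [← hw, forget, List.length_map]
    exact List.countP_le_length
  · rfl

theorem taylor_two_eq_zero {p : NCPoly g} {k : ℕ} (hp : IsHomogeneous p k) (hk : k < 2) :
    taylor 2 p = 0 := by
  rw [taylor_two_congr (q := 0), map_zero]
  intro w hw
  rw [coeff_zero, hp.coeff_eq_zero (by omega)]

theorem taylor_linForm (n : ℕ) (v : Fin g → ℝ) :
    taylor n (linForm v) = ∑ i, v i • taylor n (FreeAlgebra.ι ℝ i) := by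
  simp [linForm]

theorem taylor_two_linForm (v : Fin g → ℝ) : taylor 2 (linForm v) = 0 := by
  simp [taylor_linForm, taylor_two_ι]

theorem hasSDS_of_fintype {ι : Type*} [Fintype ι] {n : ℕ} {F : NCPolyXH g}
    {a : ι → NCPolyXH g} {b : Fin n → NCPolyXH g} (ha : ∀ i, IsLinearInH (a i))
    (hb : ∀ l, IsLinearInH (b l)) (h : F = ∑ i, star (a i) * a i - ∑ l, star (b l) * b l) :
    HasSDS F n := by
  refine ⟨Fintype.card ι, fun j => a ((Fintype.equivFin ι).symm j), b, fun j => ha _, hb, ?_⟩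
  rw [h, Equiv.sum_comp (Fintype.equivFin ι).symm fun i => star (a i) * a i]

end HDegree

/-! ### Bilinear forms of real matrices at tuples in an algebra. -/

section SumForm

variable {ι κ A : Type*} [Fintype ι] [Fintype κ] [Ring A] [Algebra ℝ A]

/-- The value `∑ Mᵢⱼ vᵢ wⱼ` of the bilinear form of a matrix at two tuples in an algebra. -/
def sumForm (M : Matrix ι κ ℝ) (v : ι → A) (w : κ → A) : A := ∑ i, ∑ j, M i j • (v i * w j)

theorem sumForm_add_right (M : Matrix ι κ ℝ) (v : ι → A) (w w' : κ → A) :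
    sumForm M v (w + w') = sumForm M v w + sumForm M v w' := by
  simp [sumForm, mul_add, Finset.sum_add_distrib]

theorem sumForm_add_left (M : Matrix ι κ ℝ) (v v' : ι → A) (w : κ → A) :
    sumForm M (v + v') w = sumForm M v w + sumForm M v' w := by
  simp [sumForm, add_mul, Finset.sum_add_distrib]

theorem sumForm_mul_right (M : Matrix ι κ ℝ) (v : ι → A) (w : κ → A) (a : A) :
    sumForm M v (fun j => w j * a) = sumForm M v w * a := by
  simp [sumForm, Finset.sum_mul, mul_assoc]

theorem sumForm_mul_left (M : Matrix ι κ ℝ) (v : ι → A) (w : κ → A) (a : A) :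
    sumForm M (fun i => a * v i) w = a * sumForm M v w := by
  simp [sumForm, Finset.mul_sum, mul_assoc]

theorem sumForm_smul_right (M : Matrix ι κ ℝ) (v : ι → A) (u : κ → ℝ) (a : A) :
    sumForm M v (fun j => u j • a) = (∑ i, (M *ᵥ u) i • v i) * a := by
  simp [sumForm, Finset.sum_mul, Matrix.mulVec, dotProduct, Finset.sum_smul, smul_smul]

theorem sumForm_smul_left (M : Matrix ι κ ℝ) (u : ι → ℝ) (w : κ → A) (a : A) :
    sumForm M (fun i => u i • a) w = a * ∑ j, (Mᵀ *ᵥ u) j • w j := by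
  simp only [sumForm, Finset.mul_sum, Matrix.mulVec, dotProduct, Finset.sum_smul, smul_smul,
    smul_mul_assoc, mul_smul_comm, Matrix.transpose_apply]
  rw [Finset.sum_comm]

theorem sumForm_mulMatrix (M : Matrix ι κ ℝ) (B : Matrix κ κ ℝ) (v : ι → A) (w : κ → A) :
    sumForm (M * B) v w = sumForm M v fun j => ∑ l, B j l • w l := by
  simp only [sumForm, Matrix.mul_apply, Finset.mul_sum, Finset.sum_smul, Finset.smul_sum,
    mul_smul_comm, smul_smul]
  refine Finset.sum_congr rfl fun i _ => ?_
  rw [Finset.sum_comm]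

theorem sumForm_transpose_mul (M : Matrix ι κ ℝ) (B : Matrix ι ι ℝ) (v : ι → A) (w : κ → A) :
    sumForm (Bᵀ * M) v w = sumForm M (fun i => ∑ l, B i l • v l) w := by
  simp only [sumForm, Matrix.mul_apply, Finset.sum_mul, Finset.sum_smul, Finset.smul_sum,
    smul_mul_assoc, smul_smul, Matrix.transpose_apply]
  rw [Finset.sum_comm_cycle]
  refine Finset.sum_congr rfl fun i _ => ?_
  rw [Finset.sum_comm]
  refine Finset.sum_congr rfl fun j _ => Finset.sum_congr rfl fun l _ => ?_
  rw [mul_comm]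

theorem sumForm_fromBlocks {ι' κ' : Type*} [Fintype ι'] [Fintype κ'] (M₁₁ : Matrix ι κ ℝ)
    (M₁₂ : Matrix ι κ' ℝ) (M₂₁ : Matrix ι' κ ℝ) (M₂₂ : Matrix ι' κ' ℝ)
    (v : ι → A) (v' : ι' → A) (w : κ → A) (w' : κ' → A) :
    sumForm (Matrix.fromBlocks M₁₁ M₁₂ M₂₁ M₂₂) (Sum.elim v v') (Sum.elim w w') =
      sumForm M₁₁ v w + sumForm M₁₂ v w' + (sumForm M₂₁ v' w + sumForm M₂₂ v' w') := by
  simp only [sumForm, Fintype.sum_sum_type, Sum.elim_inl, Sum.elim_inr,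
    Matrix.fromBlocks_apply₁₁, Matrix.fromBlocks_apply₁₂, Matrix.fromBlocks_apply₂₁,
    Matrix.fromBlocks_apply₂₂, Finset.sum_add_distrib]
  abel

end SumForm

/-! ### From the representation to squares. -/

section Hessian

variable {g : ℕ}

theorem star_sumForm (M : Matrix (Fin g) (Fin g) ℝ) (v w : Fin g → NCPolyXH g) :
    star (sumForm M v w) = sumForm Mᵀ (fun j => star (w j)) fun i => star (v i) := by
  simp only [sumForm, star_sum, star_smul_real, star_mul, Matrix.transpose_apply]
  rw [Finset.sum_comm]

theorem taylor_two_quadForm (Q : Matrix (Fin g) (Fin g) ℝ) :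
    taylor 2 (quadForm Q) = sumForm Q (fun i => taylor 1 (FreeAlgebra.ι ℝ i))
      fun j => taylor 1 (FreeAlgebra.ι ℝ j) := by
  simp [quadForm, sumForm, taylor_mul_two, taylor_two_ι]

theorem sum_projPerp_smul (u : Fin g → ℝ) (i : Fin g) :
    ∑ l, projPerp u i l • taylor 1 (FreeAlgebra.ι ℝ l) =
      taylor 1 (FreeAlgebra.ι ℝ i) - u i • taylor 1 (linForm u) := by
  simp [projPerp, Matrix.vecMulVec_apply, Matrix.one_apply, sub_smul, Finset.sum_sub_distrib,
    taylor_linForm, Finset.smul_sum, smul_smul]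

/-- The Hessian of a polynomial that has a representation, up to the factor two. -/
theorem exists_taylor_two_eq {p p₀ p₁ p₂ q f₀ : NCPoly g} {u : Fin g → ℝ}
    (h : IsRepresentation p p₀ p₁ p₂ u q f₀) :
    ∃ s : NCPolyXH g, IsLinearInH s ∧ taylor 2 p =
      sumForm (blockE p₂ u q f₀)
        (Sum.elim (fun i => taylor 1 (FreeAlgebra.ι ℝ i))
          fun i => taylor 0 (linForm u) * taylor 1 (FreeAlgebra.ι ℝ i))
        (Sum.elim (fun i => taylor 1 (FreeAlgebra.ι ℝ i))
          fun i => taylor 1 (FreeAlgebra.ι ℝ i) * taylor 0 (linForm u)) +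
      (taylor 1 (linForm u) * s + star s * taylor 1 (linForm u)) := by
  have hQ₂ : (quadMatrix p₂)ᵀ = quadMatrix p₂ := quadMatrix_transpose h.symm₂
  have hFs : (quadMatrix f₀)ᵀ = quadMatrix f₀ := by
    ext i j
    have := h.posSemidef.isHermitian.apply (Sum.inr i) (Sum.inr j)
    simpa [blockE] using this
  have hf : star f₀ = f₀ := by
    rw [← quadForm_quadMatrix h.hom_f, star_quadForm, hFs]
  have hp₂ := quadForm_quadMatrix h.hom₂
  have hq := quadForm_quadMatrix h.hom_q
  have hff := quadForm_quadMatrix h.hom_f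
  have hl : ∀ v : Fin g → ℝ, ∑ i, v i • taylor 1 (FreeAlgebra.ι ℝ i) = taylor 1 (linForm v) :=
    fun v => (taylor_linForm 1 v).symm
  have hsl : ∀ (n : ℕ) (v : Fin g → ℝ), star (taylor n (linForm v)) = taylor n (linForm v) :=
    fun n v => by rw [star_taylor, star_linForm]
  have hp := h.eq
  set Q₂ := quadMatrix p₂
  set Q := quadMatrix q
  set F := quadMatrix f₀
  set φ := taylor 1 (linForm u) with hφ
  set ψ := taylor 0 (linForm u) with hψ
  set K : Fin g → NCPolyXH g := fun i => taylor 1 (FreeAlgebra.ι ℝ i) with hK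
  -- The tuple `k` is the projection of `K` by `P`; the difference is a multiple of `φ(h)`, so every
  -- passage from `K` to `k` costs only terms with an outer factor `φ(h)`.
  set k : Fin g → NCPolyXH g := fun i => K i - u i • φ with hk
  have hKk : K = k + fun i => u i • φ := by
    ext1 i
    simp [hk]
  have hsK : (fun i => star (K i)) = K := by
    ext1 i
    rw [hK]
    simp only [star_taylor, FreeAlgebra.star_ι]
  have hsk : (fun i => star (k i)) = k := by
    ext1 i
    have := congrFun hsK i
    simp only [hk, star_sub, star_smul_real, this, hφ, hsl]
  have hPK : (fun i => ∑ l, projPerp u i l • K l) = k := by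
    ext1 i
    exact sum_projPerp_smul u i
  have hlk : ∀ v : Fin g → ℝ, ∑ i, v i • k i = taylor 1 (linForm v) - (v ⬝ᵥ u) • φ := by
    intro v
    simp only [hk, smul_sub, Finset.sum_sub_distrib, hK, hl, smul_smul, ← Finset.sum_smul]
    rfl
  -- the quadratic part
  set m := taylor 1 (linForm (Q₂ *ᵥ u)) with hm
  set c : ℝ := (Q₂ *ᵥ u) ⬝ᵥ u with hc
  -- The term `c φ φ` is shared equally between the two adjoint halves, whence `c / 2`.
  have e₂ : sumForm Q₂ K K = sumForm Q₂ k k + (φ * (m - (c / 2) • φ) + (m - (c / 2) • φ) * φ) := by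
    have e1 : sumForm Q₂ K K = sumForm Q₂ k k + (m - c • φ) * φ + φ * m := by
      conv_lhs => rw [hKk, sumForm_add_left, ← hKk, sumForm_smul_left, hQ₂, hl]
      conv_lhs => enter [1]; rw [hKk, sumForm_add_right, sumForm_smul_right, hlk]
    rw [e1]
    simp only [mul_sub, sub_mul, smul_mul_assoc, mul_smul_comm]
    module
  set t := taylor 1 (linForm (Q *ᵥ u)) with ht
  have e₃ : sumForm Q K K = sumForm Q K k + t * φ := by
    conv_lhs => enter [3]; rw [hKk]
    rw [sumForm_add_right, sumForm_smul_right, hl]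
  have e₃' : star (sumForm Q K K) = sumForm Qᵀ k K + φ * t := by
    rw [e₃, star_add, star_mul, star_sumForm, hsK, hsk, ht, hφ, hsl, hsl]
  -- `s` collects the right cofactors of `φ(h)`: from the product rule for `φ q` and `φ f₀ φ`, with
  -- the self-adjoint term `φ(h) f₀ φ(h)` halved, and from replacing `K` by `k` in `p₂` and in `q`.
  refine ⟨taylor 1 q + taylor 1 f₀ * ψ + (1 / 2 : ℝ) • (taylor 0 f₀ * φ) + (m - (c / 2) • φ) +
    t * ψ, ?_, ?_⟩
  · have hT := fun (n : ℕ) (p : NCPoly g) => isHomogeneousInH_taylor n p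
    have h1 :=
      ((((hT 1 q).add ((hT 1 f₀).mul (hT 0 (linForm u)))).add
        (((hT 0 f₀).mul (hT 1 (linForm u))).smul (1 / 2))).add
          ((hT 1 (linForm (Q₂ *ᵥ u))).sub ((hT 1 (linForm u)).smul (c / 2)))).add
            ((hT 1 (linForm (Q *ᵥ u))).mul (hT 0 (linForm u)))
    exact h1
  · have hE : sumForm (blockE p₂ u q f₀) (Sum.elim K fun i => ψ * K i)
        (Sum.elim K fun i => K i * ψ) =
        sumForm Q₂ k k + sumForm Qᵀ k K * ψ +
          (ψ * sumForm Q K k + ψ * sumForm F K K * ψ) := by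
      have h1 : projPerp u * Q₂ * projPerp u = (projPerp u)ᵀ * (Q₂ * projPerp u) := by
        rw [projPerp_transpose, Matrix.mul_assoc]
      have h2 : projPerp u * Qᵀ = (projPerp u)ᵀ * Qᵀ := by rw [projPerp_transpose]
      rw [blockE, sumForm_fromBlocks, h1, h2, sumForm_transpose_mul, sumForm_transpose_mul,
        sumForm_mulMatrix, sumForm_mulMatrix, hPK, sumForm_mul_right, sumForm_mul_right,
        sumForm_mul_left, sumForm_mul_left]
    have hq2 : taylor 2 q = sumForm Q K K := by rw [← hq, taylor_two_quadForm]
    have hf2 : taylor 2 f₀ = sumForm F K K := by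
      rw [← hff, taylor_two_quadForm]
    have hp2 : taylor 2 p₂ = sumForm Q₂ K K := by
      rw [← hp₂, taylor_two_quadForm]
    have hst : star t = t := hsl 1 _
    have hsm : star m = m := hsl 1 _
    have hsφ : star φ = φ := hsl 1 _
    have hsψ : star ψ = ψ := hsl 0 _
    rw [hE, hp]
    simp only [map_add, taylor_two_eq_zero h.hom₀ (by norm_num),
      taylor_two_eq_zero h.hom₁ (by norm_num), taylor_mul_two, taylor_mul_one, taylor_mul_zero,
      taylor_two_linForm, ← star_taylor, hp2, hq2, hf2, e₂, e₃', ← hφ, ← hψ, star_add, star_sub,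
      star_smul_real, star_mul, hst, hsm, hsφ, hsψ]
    simp only [star_taylor, hf]
    rw [e₃]
    simp only [mul_add, add_mul, mul_sub, sub_mul, smul_mul_assoc, mul_smul_comm, mul_assoc,
      zero_mul, mul_zero]
    module

theorem sqrt_two_smul_star_mul (a : NCPolyXH g) :
    star (Real.sqrt 2 • a) * (Real.sqrt 2 • a) = (2 : ℝ) • (star a * a) := by
  rw [star_smul_real, smul_mul_smul_comm, Real.mul_self_sqrt (by norm_num)]

theorem hasSDS_one_of_isRepresentation {p p₀ p₁ p₂ q f₀ : NCPoly g} {u : Fin g → ℝ}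
    (h : IsRepresentation p p₀ p₁ p₂ u q f₀) : HasSDS (hessian p) 1 := by
  obtain ⟨s, hs, e⟩ := exists_taylor_two_eq h
  obtain ⟨B, hB⟩ := exists_eq_transpose_mul_self h.posSemidef
  set φ := taylor 1 (linForm u) with hφ
  set V : Fin g ⊕ Fin g → NCPolyXH g := Sum.elim (fun i => taylor 1 (FreeAlgebra.ι ℝ i))
    fun i => taylor 1 (FreeAlgebra.ι ℝ i) * taylor 0 (linForm u) with hV
  have hV' : (Sum.elim (fun i => taylor 1 (FreeAlgebra.ι ℝ i))
      fun i => taylor 0 (linForm u) * taylor 1 (FreeAlgebra.ι ℝ i)) = fun i => star (V i) := by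
    ext1 i
    cases i <;> simp [hV, star_taylor, star_linForm]
  have hφs : star φ = φ := by rw [hφ, star_taylor, star_linForm]
  have hφl : IsHomogeneousInH φ 1 := isHomogeneousInH_taylor 1 _
  have hVl : ∀ i, IsHomogeneousInH (V i) 1 := by
    rintro (i | i)
    · exact isHomogeneousInH_taylor 1 _
    · exact (isHomogeneousInH_taylor 1 _).mul (isHomogeneousInH_taylor 0 _)
  have e' : taylor 2 p = ∑ r, star (∑ i, B r i • V i) * ∑ i, B r i • V i +
      (φ * s + star s * φ) := by
    rw [e, hV', hB, sumForm, sum_transpose_mul_self_smul]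
    simp only [star_sum, star_smul_real]
  -- The extra index carries the polarization: the squares of `φ + s` and `φ - s` differ by `2 (φ s
  -- + star s φ)`. The other squares absorb the factor two of the Hessian into a square root.
  refine hasSDS_of_fintype (ι := Option (Fin g ⊕ Fin g))
    (a := fun r => r.elim (φ + s) fun r => Real.sqrt 2 • ∑ i, B r i • V i)
    (b := fun _ => φ - s) ?_ (fun _ => hφl.sub hs) ?_
  · rintro (_ | r)
    · exact hφl.add hs
    · exact (IsHomogeneousInH.sum _ fun i _ => (hVl i).smul _).smul _
  · rw [hessian_eq, e']
    simp only [Fintype.sum_option, Option.elim, sqrt_two_smul_star_mul, ← Finset.smul_sum,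
      Finset.univ_unique, Finset.sum_const, Finset.card_singleton, one_smul, star_add, star_sub,
      hφs, mul_add, add_mul, mul_sub, sub_mul]
    module

theorem hasSDS_zero_of_posSemidef {p : NCPoly g} (hd : degree p ≤ 2)
    (h : (quadMatrix p).PosSemidef) : HasSDS (hessian p) 0 := by
  obtain ⟨B, hB⟩ := exists_eq_transpose_mul_self h
  have e : taylor 2 p = taylor 2 (quadForm (quadMatrix p)) := by
    apply taylor_two_congr
    intro w hw
    by_cases hw2 : w.length = 2
    · obtain ⟨i, j, rfl⟩ := List.length_eq_two.mp hw2
      simp [quadMatrix]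
    · rw [coeff_eq_zero_of_degree_lt (by omega), (isHomogeneous_quadForm _).coeff_eq_zero hw2]
  refine hasSDS_of_fintype (b := Fin.elim0)
    (a := fun r => Real.sqrt 2 • ∑ i, B r i • taylor 1 (FreeAlgebra.ι ℝ i)) (fun r => ?_)
    (fun l => l.elim0) ?_
  · exact (IsHomogeneousInH.sum _ fun i _ => (isHomogeneousInH_taylor 1 _).smul _).smul _
  · simp only [sqrt_two_smul_star_mul, ← Finset.smul_sum, Finset.univ_eq_empty, Finset.sum_empty,
      sub_zero]
    simp only [star_sum, star_smul_real, star_taylor, FreeAlgebra.star_ι]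
    rw [← sum_transpose_mul_self_smul, ← hB, hessian_eq, e, taylor_two_quadForm, sumForm]

end Hessian

/-! ### Polynomials of degree three. -/

section Cubic

variable {g : ℕ}

/-- Choose `i` with `u i ≠ 0`: among the terms of the representation only `φ f₀ φ` contributes to
the word `i j k i`, whose coefficient in `p` is zero. -/
theorem IsRepresentation.eq_zero_of_degree_eq_three {p p₀ p₁ p₂ q f₀ : NCPoly g} {u : Fin g → ℝ}
    (h : IsRepresentation p p₀ p₁ p₂ u q f₀) (hd : degree p = 3) : f₀ = 0 := by
  obtain ⟨i, hi⟩ : ∃ i, u i ≠ 0 := by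
    by_contra! hu
    have := h.unit
    simp [dotProduct, hu] at this
  rw [← quadForm_quadMatrix h.hom_f]
  suffices quadMatrix f₀ = 0 by simp [this, quadForm]
  ext j k
  have hφ := isHomogeneous_linForm u
  have h0 : coeff p [i, j, k, i] = 0 := coeff_eq_zero_of_degree_lt (by simp [hd])
  have hc : coeff (linForm u * f₀ * linForm u) [i, j, k, i] = u i * coeff f₀ [j, k] * u i := by
    rw [show [i, j, k, i] = [i, j, k] ++ [i] from rfl, coeff_mul_linForm_append,
      coeff_linForm_mul_cons]
  rw [h.eq] at h0
  simp only [coeff_add] at h0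
  rw [h.hom₀.coeff_eq_zero (by simp), h.hom₁.coeff_eq_zero (by simp),
    h.hom₂.coeff_eq_zero (by simp), (hφ.mul h.hom_q).coeff_eq_zero (by simp),
    (h.hom_q.star.mul hφ).coeff_eq_zero (by simp), hc] at h0
  simpa [hi, quadMatrix] using h0

/-- A zero diagonal block of a positive semidefinite matrix forces the off-diagonal block `Q(q) P`
to vanish. Then `Q(q)` equals `Q(q) u uᵀ`, so `f₁` is the linear form of `Q(q) u`. -/
theorem IsRepresentation.exists_eq_mul_linForm {p p₀ p₁ p₂ q : NCPoly g} {u : Fin g → ℝ}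
    (h : IsRepresentation p p₀ p₁ p₂ u q 0) :
    ∃ f₁ : NCPoly g, IsHomogeneous f₁ 1 ∧ q = f₁ * linForm u := by
  have hφ := isHomogeneous_linForm (g := g)
  refine ⟨linForm (quadMatrix q *ᵥ u), hφ _, ?_⟩
  apply ext_coeff
  intro w
  by_cases hw : w.length = 2
  · obtain ⟨i, j, rfl⟩ := List.length_eq_two.mp hw
    have h0 : Pi.single i 1 ⬝ᵥ quadMatrix q *ᵥ (projPerp u *ᵥ Pi.single j 1) = 0 := by
      apply eq_zero_of_forall_add_mul_nonneg
      intro t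
      -- With `f₀ = 0` the form of `E₂` is affine in the scale `t` of the second component.
      have := h.posSemidef.dotProduct_mulVec_nonneg (Sum.elim (Pi.single j 1)
        (t • Pi.single i 1))
      rw [star_trivial, blockE_quadratic, Sum.elim_comp_inl, Sum.elim_comp_inr,
        show quadMatrix (0 : NCPoly g) = 0 by ext; simp [quadMatrix], Matrix.zero_mulVec,
        dotProduct_zero, add_zero, smul_dotProduct, smul_eq_mul, ← mul_assoc] at this
      exact this
    rw [single_dotProduct, one_mul, projPerp_mulVec, Matrix.mulVec_sub, Matrix.mulVec_smul] at h0
    simp at h0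
    rw [coeff_linForm_mul_cons, coeff_linForm]
    have e : quadMatrix q i j = coeff q [i, j] := rfl
    rw [← e]
    linarith
  · rw [h.hom_q.coeff_eq_zero hw, ((hφ _).mul (hφ _)).coeff_eq_zero hw]

end Cubic

/-! ### The least number of negative squares. -/

section Signature

variable {g : ℕ}

theorem negSignature_le_iff {F : NCPolyXH g} {n : ℕ} :
    negSignature F ≤ n ↔ ∃ k ≤ n, HasSDS F k := by
  constructor
  · intro h
    by_contra! hk
    have : ((n + 1 : ℕ) : ℕ∞) ≤ negSignature F := by
      refine le_iInf₂ fun k hF => ?_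
      by_contra! hlt
      exact hk k (Nat.lt_succ_iff.mp (by exact_mod_cast hlt)) hF
    have h2 : n + 1 ≤ n := by exact_mod_cast this.trans h
    omega
  · rintro ⟨k, hk, hF⟩
    exact iInf₂_le_of_le k hF (by exact_mod_cast hk)

/-- The zero polynomial counts as linear in `h`, so a representation can be padded with a zero
square. -/
theorem HasSDS.succ {F : NCPolyXH g} {n : ℕ} (h : HasSDS F n) : HasSDS F (n + 1) := by
  obtain ⟨m, a, b, ha, hb, e⟩ := h
  refine ⟨m, a, Fin.cons 0 b, ha, ?_, ?_⟩
  · refine Fin.cases ?_ fun l => ?_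
    · exact isHomogeneousInH_zero 1
    · exact hb l
  · simp [e, Fin.sum_univ_succ]

theorem negSignature_le_one_iff {F : NCPolyXH g} : negSignature F ≤ 1 ↔ HasSDS F 1 := by
  rw [← Nat.cast_one, negSignature_le_iff]
  constructor
  · rintro ⟨k, hk, h⟩
    interval_cases k
    · exact h.succ
    · exact h
  · exact fun h => ⟨1, le_rfl, h⟩

theorem negSignature_eq_zero_iff {F : NCPolyXH g} : negSignature F = 0 ↔ HasSDS F 0 := by
  rw [← nonpos_iff_eq_zero, ← Nat.cast_zero, negSignature_le_iff]
  constructor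
  · rintro ⟨k, hk, h⟩
    obtain rfl := Nat.le_zero.mp hk
    exact h
  · exact fun h => ⟨0, le_rfl, h⟩

end Signature

end NCPoly

theorem theorem1p2 {g : ℕ} (hg : 1 ≤ g) (p : NCPoly g) (hp : IsSelfAdjoint p) :
    (NCPoly.negSignature (NCPoly.hessian p) ≤ 1 ↔
      ∃ (p₀ p₁ p₂ : NCPoly g) (u : Fin g → ℝ) (q f₀ : NCPoly g),
        NCPoly.IsRepresentation p p₀ p₁ p₂ u q f₀) ∧
    (∀ (p₀ p₁ p₂ : NCPoly g) (u : Fin g → ℝ) (q f₀ : NCPoly g),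
      NCPoly.IsRepresentation p p₀ p₁ p₂ u q f₀ → NCPoly.degree p = 3 →
        f₀ = 0 ∧ ∃ f₁ : NCPoly g, NCPoly.IsHomogeneous f₁ 1 ∧ q = f₁ * NCPoly.linForm u) ∧
    (NCPoly.negSignature (NCPoly.hessian p) = 0 ↔
      NCPoly.degree p ≤ 2 ∧ NCPoly.MatrixPositive (NCPoly.homogeneousPart p 2)) := by
  rw [NCPoly.negSignature_le_one_iff, NCPoly.negSignature_eq_zero_iff]
  refine ⟨⟨fun h => ?_, ?_⟩, ?_, NCPoly.degree_le_two_and_matrixPositive hp, ?_⟩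
  · obtain ⟨u, hu, hC⟩ := NCPoly.exists_unit_hankel_nonneg hg hp h
    exact NCPoly.exists_isRepresentation hu hp hC
  · rintro ⟨p₀, p₁, p₂, u, q, f₀, h⟩
    exact NCPoly.hasSDS_one_of_isRepresentation h
  · intro p₀ p₁ p₂ u q f₀ h hd
    obtain rfl := h.eq_zero_of_degree_eq_three hd
    exact ⟨rfl, h.exists_eq_mul_linForm⟩
  · rintro ⟨hd, h⟩
    apply NCPoly.hasSDS_zero_of_posSemidef hd
    rw [← NCPoly.quadMatrix_homogeneousPart]
    exact NCPoly.posSemidef_of_matrixPositive (NCPoly.isHomogeneous_homogeneousPart p 2)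
      (NCPoly.isSelfAdjoint_homogeneousPart hp 2) h
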